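/- **Setting.** Let $K$ be a field which is complete with respect to a non-trivial non-archimedean absolute value, $R=\{x\in K:|x|\le 1\}$ its valuation ring, $\mathfrak m_R$ the maximal ideal and $k=R/\mathfrak m_R$ the residue field. Let $\mathbb F_\epsilon$ be a finite field with $\hat q$ elements, let $R$ be an $\mathbb F_\epsilon$-algebra, let $0\ne\zeta\in\mathfrak m_R$, and fix a ring homomorphism $k\to R$ which is a section of $R\to k$. On power series and Laurent series in $z$ let $\hat\sigma$ denote the endomorphism which fixes $z$ and raises the coefficients to the $\hat q$-th power. Let $$R[[z,z^{-1}\}=\Bigl\{\sum_{i\in\mathbb Z}b_iz^i:\ b_i\in R,\ |b_i||\zeta|^{ri}\to0\ (i\to-\infty)\text{ for all }r>0\Bigr\},\qquad \ell_-=\prod_{i\ge0}\Bigl(1-\frac{\zeta^{\hat q^i}}{z}\Bigr)\in R[[z,z^{-1}\}.$$ The section gives a homomorphism $k((z))\to R[[z,z^{-1}\}$, and expansion at $z=\zeta$, $\sum_i b_iz^i\mapsto\sum_j\bigl(\sum_i\binom ij b_i\zeta^{i-j}\bigr)(z-\zeta)^j$, gives a homomorphism $R[[z,z^{-1}\}\to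 K[[z-\zeta]]$. A *local shtuka* over $R$ is a finite free $R[[z]]$-module $\hat M$ with an isomorphism $\tau:\hat\sigma^*\hat M[\frac1{z-\zeta}]\to\hat M[\frac1{z-\zeta}]$. Put $\tilde D=\hat M\otimes_{R[[z]]}k((z))$ with the induced $\tau_{\tilde D}:\hat\sigma^*\tilde D\to\tilde D$. A *rigidification* is an isomorphism $$\delta:\hat M\otimes_{R[[z]]}R[[z,z^{-1}\}[\ell_-^{-1}]\ \to\ \tilde D\otimes_{k((z))}R[[z,z^{-1}\}[\ell_-^{-1}]$$ with $\delta\circ\tau=\tau_{\tilde D}\circ\hat\sigma^*\delta$ and $\delta\equiv\mathrm{id}_{\tilde D}\bmod\mathfrak m_R$. A *quasi-morphism* of rigidified local shtukas is an $R((z))$-linear map $f:\hat M[\frac1z]\to\hat M'[\frac1z]$ with $\tau'\circ\hat\sigma^*f=f\circ\tau$ which commutes with the rigidifications; the morphisms are the quasi-morphisms mapping $\hat M$ into $\hat M'$. *Realizations.* $H^1_{dR}(\hat M,B)=\hat\sigma^*\hat M\otimes_{R[[z]]}B$ for $B=K[[z-\zeta]]$, $K((z-\zeta))$ or $K$ (the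 last with $z\mapsto\zeta$), with Hodge–Pink lattice $\mathfrak q=\tau^{-1}(\hat M\otimes_{R[[z]]}K[[z-\zeta]])\subset H^1_{dR}(\hat M,K((z-\zeta)))$. The crystalline realization is $D=H^1_{cris}(\hat M,k((z)))=\hat\sigma^*\hat M\otimes_{R[[z]]}k((z))$, with Frobenius $\tau_D=\hat\sigma^*\tau_{\tilde D}$ and Hodge–Pink lattice $\mathfrak q_D=\hat\sigma^*\delta\circ\tau^{-1}(\hat M\otimes_{R[[z]]}K[[z-\zeta]])\subset D\otimes_{k((z))}K((z-\zeta))$. The lattice $\mathfrak q$ defines the Hodge–Pink filtration of $H^1_{dR}(\hat M,K)$: $F^i$ is the image of $\mathfrak p\cap(z-\zeta)^i\mathfrak q$, where $\mathfrak p=H^1_{dR}(\hat M,K[[z-\zeta]])$. In the same way $\mathfrak q_D$ and $\mathfrak p_D=D\otimes_{k((z))}K[[z-\zeta]]$ define the Hodge–Pink filtration of $D_K=D\otimes_{k((z)),z\mapsto\zeta}K$. The integral structures are $H^1_{dR}(\hat M,R)=\hat\sigma^*\hat M/(z-\zeta)\hat\sigma^*\hat M\subset H^1_{dR}(\hat M,K)$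 and $H^1_{cris}(\hat M,k[[z]])=\hat\sigma^*\hat M\otimes_{R[[z]]}k[[z]]\subset D$. **Theorem.** Let $\hat M$ be a rigidified local shtuka over $R$. The canonical maps $\hat\sigma^*\delta\otimes\mathrm{id}$, $$h_{dR,cris}:H^1_{dR}(\hat M,K[[z-\zeta]])\to H^1_{cris}(\hat M,k((z)))\otimes_{k((z))}K[[z-\zeta]],$$ $$h_{dR,cris}:H^1_{dR}(\hat M,K)\to H^1_{cris}(\hat M,k((z)))\otimes_{k((z)),z\mapsto\zeta}K,$$ are isomorphisms, and the second is the reduction of the first modulo $z-\zeta$. They are functorial in $\hat M$ with respect to quasi-morphisms of rigidified local shtukas. They are compatible with Hodge–Pink lattices, $(h_{dR,cris}\otimes\mathrm{id}_{K((z-\zeta))})(\mathfrak q)=\mathfrak q_D$, and with Hodge–Pink filtrations, $h_{dR,cris}(F^iH^1_{dR}(\hat M,K))=F^iD_K$ for all $i\in\mathbb Z$. In general they are not compatible with the integral structures: there are $\mathbb F_\epsilon$, $K$, $\zeta$, a section $k\to R$ and a rigidified local shtuka $\hat M$ over $R$ for which $h_{dR,cris}(H^1_{dR}(\hat M,R))$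 is different from the image of $H^1_{cris}(\hat M,k[[z]])\otimes_{k[[z]],z\mapsto\zeta}R$ in $D_K$. -/

import Mathlib

set_option linter.unusedSectionVars false

universe u v w

open scoped TensorProduct

/-! ## Base change of modules along ring homomorphisms -/

section BaseChange

universe u₁ u₂ u₃ u₄ u₅

/-- The ring `B`, regarded as an `A`-algebra through the ring homomorphism `f : A → B`. -/
def Along {A : Type u₁} {B : Type u₂} [CommRing A] [CommRing B] (_f : A →+* B) : Type u₂ := B

namespace Along

variable {A : Type u₁} {B : Type u₂} {C : Type u₃} [CommRing A] [CommRing B] [CommRing C]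
  (f : A →+* B)

instance : CommRing (Along f) := inferInstanceAs (CommRing B)

instance : Algebra A (Along f) := f.toAlgebra

instance [Algebra C B] : Module C (Along f) := inferInstanceAs (Module C B)

instance [Algebra C B] : IsScalarTower C B (Along f) :=
  inferInstanceAs (IsScalarTower C B B)

instance [Algebra C B] : SMulCommClass A C (Along f) :=
  ⟨fun a c (b : B) => mul_smul_comm c (f a) b⟩

end Along

/-- The base change `M ⊗_{A, f} B` of an `A`-module `M` along a ring homomorphism `f : A → B`. -/
def BC {A : Type u₁} {B : Type u₂} [CommRing A] [CommRing B] (f : A →+* B)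
    (M : Type u₄) [AddCommGroup M] [Module A M] : Type (max u₂ u₄) :=
  Along f ⊗[A] M

namespace BC

variable {A : Type u₁} {B : Type u₂} {C : Type u₃} [CommRing A] [CommRing B] [CommRing C]
  (f : A →+* B) (M : Type u₄) [AddCommGroup M] [Module A M]
  {N : Type u₅} [AddCommGroup N]

instance : AddCommGroup (BC f M) := inferInstanceAs (AddCommGroup (Along f ⊗[A] M))

/-- `M ⊗_{A, f} B` is a module over `B`, and over every ring `C` over which `B` is an algebra. -/
instance [Algebra C B] : Module C (BC f M) := inferInstanceAs (Module C (Along f ⊗[A] M))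

instance [Algebra C B] : IsScalarTower C B (BC f M) :=
  inferInstanceAs (IsScalarTower C B (Along f ⊗[A] M))

variable {M}

/-- The canonical `f`-semilinear map `M → M ⊗_{A, f} B`, `m ↦ m ⊗ 1`. -/
def mk : M →ₛₗ[f] BC f M where
  toFun m := (1 : Along f) ⊗ₜ[A] m
  map_add' x y := TensorProduct.tmul_add _ _ _
  map_smul' a x := by
    change (1 : Along f) ⊗ₜ[A] (a • x) = f a • ((1 : Along f) ⊗ₜ[A] x)
    rw [← TensorProduct.smul_tmul, TensorProduct.smul_tmul', Algebra.smul_def]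
    rfl

variable {f}

theorem smul_mk (b : B) (m : M) :
    b • mk f m = (TensorProduct.tmul A (M := Along f) b m : Along f ⊗[A] M) := by
  change b • ((1 : Along f) ⊗ₜ[A] m) = _
  rw [TensorProduct.smul_tmul']
  exact congrArg (fun c : Along f => c ⊗ₜ[A] m) (mul_one b)

theorem induction {p : BC f M → Prop} (x : BC f M) (h0 : p 0)
    (hmk : ∀ (b : B) (m : M), p (b • mk f m)) (hadd : ∀ x y, p x → p y → p (x + y)) : p x := by
  refine TensorProduct.induction_on (motive := p) x h0 (fun b m => ?_) hadd
  exact (congrArg p (smul_mk (f := f) b m)).mp (hmk b m)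

/-- Two semilinear maps on `M ⊗_{A, f} B` agree if they agree on the elements `m ⊗ 1`. -/
theorem ext_mk {φ : B →+* C} [Module C N] {u v : BC f M →ₛₗ[φ] N}
    (h : ∀ m, u (mk f m) = v (mk f m)) : u = v := by
  ext x
  induction x using BC.induction with
  | h0 => simp
  | hmk b m => simp only [map_smulₛₗ, h]
  | hadd x y hx hy => simp only [map_add, hx, hy]

/-- Universal property of base change: a map `h : M → N` which is semilinear over
`e = φ ∘ f` extends (uniquely) to a `φ`-semilinear map `M ⊗_{A, f} B → N`. -/
def lift (φ : B →+* C) {e : A →+* C} (he : φ.comp f = e) [Module C N] (h : M →ₛₗ[e] N) :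
    BC f M →ₛₗ[φ] N where
  toFun := TensorProduct.liftAddHom
    (AddMonoidHom.mk' (fun b : Along f => AddMonoidHom.mk' (fun m : M => φ b • h m)
        (fun x y => by rw [map_add, smul_add]))
      (fun x y => by
        ext m
        exact (congrArg (· • h m) (φ.map_add x y)).trans (add_smul _ _ _)))
    (fun a (b : B) m => by
      have h1 : φ (f a * b) = e a * φ b := by rw [map_mul, ← he]; rfl
      have h2 : h (a • m) = e a • h m := h.map_smulₛₗ a m
      change φ (f a * b) • h m = φ b • h (a • m)
      rw [h1, h2, smul_smul, mul_comm])
  map_add' := map_add _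
  map_smul' b x := by
    refine TensorProduct.induction_on (motive := fun x : Along f ⊗[A] M =>
      TensorProduct.liftAddHom _ _ (b • x) = φ b • TensorProduct.liftAddHom _ _ x) x ?_
      (fun c m => ?_) (fun x y hx hy => ?_)
    · rw [smul_zero, map_zero, smul_zero]
    · exact (congrArg (· • h m) (φ.map_mul b c)).trans (mul_smul _ _ _)
    · rw [smul_add, map_add, map_add, smul_add, hx, hy]

@[simp] theorem lift_mk (φ : B →+* C) {e : A →+* C} (he : φ.comp f = e) [Module C N]
    (h : M →ₛₗ[e] N) (m : M) : lift φ he h (mk f m) = h m := by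
  change φ 1 • h m = h m
  rw [map_one, one_smul]

variable {M' : Type u₅} [AddCommGroup M'] [Module A M']

/-- The base change `u ⊗ id : M ⊗_{A, f} B → M' ⊗_{A, f} B` of an `A`-linear map `u`. -/
def map (f : A →+* B) (u : M →ₗ[A] M') : BC f M →ₗ[B] BC f M' :=
  lift (RingHom.id B) (RingHom.id_comp f)
    { toFun := fun m => mk f (u m)
      map_add' := fun x y => by rw [map_add, map_add]
      map_smul' := fun a x => by rw [map_smul, map_smulₛₗ] }

@[simp] theorem map_mk (u : M →ₗ[A] M') (m : M) : map f u (mk f m) = mk f (u m) :=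
  lift_mk _ _ _ _

/-- The base change of an `A`-linear isomorphism. -/
def mapEquiv (f : A →+* B) (u : M ≃ₗ[A] M') : BC f M ≃ₗ[B] BC f M' :=
  LinearEquiv.ofLinearMap (map f u.toLinearMap) (map f u.symm.toLinearMap)
    (ext_mk fun m => by simp) (ext_mk fun m => by simp)

@[simp] theorem mapEquiv_mk (u : M ≃ₗ[A] M') (m : M) : mapEquiv f u (mk f m) = mk f (u m) :=
  map_mk _ _

/-- For `ψ : B → C` the canonical `ψ`-semilinear map `M ⊗_{A, f} B → M ⊗_{A, ψ ∘ f} C`,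
`m ⊗ b ↦ m ⊗ ψ(b)`. -/
def push (ψ : B →+* C) {e : A →+* C} (h : ψ.comp f = e) : BC f M →ₛₗ[ψ] BC e M :=
  lift ψ h (mk e)

@[simp] theorem push_mk (ψ : B →+* C) {e : A →+* C} (h : ψ.comp f = e) (m : M) :
    push ψ h (mk f m) = mk e m :=
  lift_mk _ _ _ _

/-- Transitivity of base change: `(M ⊗_{A, f} B) ⊗_{B, g} C ≅ M ⊗_{A, g ∘ f} C`. -/
def compEquiv {g : B →+* C} {e : A →+* C} (h : g.comp f = e) : BC g (BC f M) ≃ₗ[C] BC e M :=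
  LinearEquiv.ofLinearMap (lift (RingHom.id C) (RingHom.id_comp g) (push g h))
    (lift (RingHom.id C) (RingHom.id_comp e)
      { toFun := fun m => mk g (mk f m)
        map_add' := fun x y => by rw [map_add, map_add]
        map_smul' := fun a x => by rw [map_smulₛₗ, map_smulₛₗ, ← h]; rfl })
    (ext_mk fun m => by simp)
    (ext_mk fun x => by
      induction x using BC.induction with
      | h0 => simp only [map_zero]
      | hmk b m => simp
      | hadd x y hx hy => simpa only [map_add] using congrArg₂ (· + ·) hx hy)

@[simp] theorem compEquiv_mk_mk {g : B →+* C} {e : A →+* C} (h : g.comp f = e) (m : M) :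
    compEquiv h (mk g (mk f m)) = mk e m := by
  change lift (RingHom.id C) (RingHom.id_comp g) (push g h) (mk g (mk f m)) = _
  rw [lift_mk, push_mk]

@[simp] theorem compEquiv_symm_mk {g : B →+* C} {e : A →+* C} (h : g.comp f = e) (m : M) :
    (compEquiv h).symm (mk e m) = mk g (mk f m) := by
  rw [LinearEquiv.symm_apply_eq, compEquiv_mk_mk]

/-- For a commutative square of ring homomorphisms `g₁ ∘ f₁ = g₂ ∘ f₂` the canonical isomorphism
`(M ⊗_{A, f₁} B₁) ⊗_{B₁, g₁} C ≅ (M ⊗_{A, f₂} B₂) ⊗_{B₂, g₂} C`. -/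
def swap {B₂ : Type u₅} [CommRing B₂] {g₁ : B →+* C} {f₁ : A →+* B} {g₂ : B₂ →+* C}
    {f₂ : A →+* B₂} (h : g₁.comp f₁ = g₂.comp f₂) :
    BC g₁ (BC f₁ M) ≃ₗ[C] BC g₂ (BC f₂ M) :=
  (compEquiv h).trans (compEquiv (rfl : g₂.comp f₂ = g₂.comp f₂)).symm

@[simp] theorem swap_mk_mk {B₂ : Type u₅} [CommRing B₂] {g₁ : B →+* C} {f₁ : A →+* B}
    {g₂ : B₂ →+* C} {f₂ : A →+* B₂} (h : g₁.comp f₁ = g₂.comp f₂) (m : M) :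
    swap h (mk g₁ (mk f₁ m)) = mk g₂ (mk f₂ m) := by
  simp [swap]

/-- If `g ∘ f = id_A` then `(M ⊗_{A, f} B) ⊗_{B, g} A` is canonically identified with `M`. -/
def cancel {g : B →+* A} (h : g.comp f = RingHom.id A) : BC g (BC f M) →ₗ[A] M :=
  lift (RingHom.id A) (RingHom.id_comp g) (lift g h LinearMap.id)

@[simp] theorem cancel_mk_mk {g : B →+* A} (h : g.comp f = RingHom.id A) (m : M) :
    cancel h (mk g (mk f m)) = m := by
  simp [cancel]

end BC

end BaseChange

/-! ## The base ring -/

noncomputable section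

open Filter Topology

namespace LocSht

/-- The valuation ring `R = {x ∈ K : |x| ≤ 1}` of a non-archimedean field `K`. -/
abbrev ValRing (K : Type v) [NontriviallyNormedField K] [IsUltrametricDist K] : ValuationSubring K :=
  (NormedField.valuation (K := K)).valuationSubring

/-- The residue field `k = R / 𝔪_R`. -/
abbrev ResField (K : Type v) [NontriviallyNormedField K] [IsUltrametricDist K] : Type v :=
  IsLocalRing.ResidueField (ValRing K)

/-- The arithmetic data over a complete valuation ring `R` with residue field `k`, which is an
algebra over the finite field `𝔽_ε`: the image `ζ ∈ 𝔪_R ∖ {0}` of the uniformizer `z` of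
`A_ε = 𝔽_ε⟦z⟧`, and a section `k → R` of the residue map. -/
structure BaseDatum (Fε : Type u) (K : Type v) [Field Fε] [Fintype Fε] [NontriviallyNormedField K]
    [IsUltrametricDist K] [Algebra Fε (ValRing K)] where
  ζ : ValRing K
  ζ_ne_zero : ζ ≠ 0
  ζ_mem : ζ ∈ IsLocalRing.maximalIdeal (ValRing K)
  sec : ResField K →+* ValRing K
  residue_comp_sec : (IsLocalRing.residue (ValRing K)).comp sec = RingHom.id (ResField K)

section ValRing

variable {K : Type v} [NontriviallyNormedField K] [IsUltrametricDist K]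

theorem mem_valRing (x : K) : x ∈ ValRing K ↔ ‖x‖ ≤ 1 := by
  rw [Valuation.mem_valuationSubring_iff]; rfl

theorem norm_le_one (x : ValRing K) : ‖x‖ ≤ 1 := (mem_valRing (x : K)).1 x.2

theorem norm_mul' (x y : ValRing K) : ‖x * y‖ = ‖x‖ * ‖y‖ := norm_mul (x : K) (y : K)

theorem norm_pow' (x : ValRing K) (n : ℕ) : ‖x ^ n‖ = ‖x‖ ^ n := norm_pow (x : K) n

theorem norm_mul_le_left (x y : ValRing K) : ‖x * y‖ ≤ ‖x‖ := by
  rw [norm_mul']; exact mul_le_of_le_one_right (norm_nonneg _) (norm_le_one y)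

theorem norm_mul_le_right (x y : ValRing K) : ‖x * y‖ ≤ ‖y‖ := by
  rw [norm_mul']; exact mul_le_of_le_one_left (norm_nonneg _) (norm_le_one x)

theorem mem_maximalIdeal_iff (x : ValRing K) :
    x ∈ IsLocalRing.maximalIdeal (ValRing K) ↔ ‖x‖ < 1 := by
  rw [IsLocalRing.mem_maximalIdeal, mem_nonunits_iff, not_iff_comm, not_lt]
  constructor
  · intro h
    have h0 : (x : K) ≠ 0 := by
      intro h0
      have : ‖x‖ = 0 := by change ‖(x : K)‖ = 0; rw [h0, norm_zero]
      linarith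
    have hinv : (x : K)⁻¹ ∈ ValRing K := by
      rw [mem_valRing, norm_inv]
      exact inv_le_one_of_one_le₀ h
    exact IsUnit.of_mul_eq_one ⟨(x : K)⁻¹, hinv⟩ (Subtype.ext (mul_inv_cancel₀ h0))
  · rintro ⟨u, rfl⟩
    have h1 : ‖(u : ValRing K)‖ * ‖((u⁻¹ : (ValRing K)ˣ) : ValRing K)‖ = 1 := by
      rw [← norm_mul', Units.mul_inv, norm_one]
    nlinarith [norm_le_one ((u⁻¹ : (ValRing K)ˣ) : ValRing K), norm_nonneg (u : ValRing K)]

instance [CompleteSpace K] : CompleteSpace (ValRing K) := by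
  have : IsClosed ((ValRing K : Set K)) := by
    have h : (ValRing K : Set K) = Metric.closedBall 0 1 := by
      ext x
      rw [mem_closedBall_zero_iff]
      exact mem_valRing x
    rw [h]; exact Metric.isClosed_closedBall
  exact this.completeSpace_coe

instance : NonarchimedeanRing (ValRing K) where
  is_nonarchimedean := NonarchimedeanAddGroup.is_nonarchimedean

instance nonarchimedeanRing_field : NonarchimedeanRing K where
  is_nonarchimedean := NonarchimedeanAddGroup.is_nonarchimedean

end ValRing

/-- The product of two Laurent series with support in `[-N, ∞)`. -/
theorem laurent_coeff_mul {T : Type*} [CommRing T] (x y : LaurentSeries T) (N n : ℤ)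
    (hx : ∀ i < -N, x.coeff i = 0) (hy : ∀ i < -N, y.coeff i = 0) :
    (x * y).coeff n = ∑ i ∈ Finset.Icc (-N) (n + N), x.coeff i * y.coeff (n - i) := by
  rw [HahnSeries.coeff_mul]
  refine Finset.sum_bij_ne_zero (fun ij _ _ => ij.1) ?_ ?_ ?_ ?_
  · intro ij h hne
    have h1 := (Finset.mem_antidiagonal.1 h).2.2
    have hi : -N ≤ ij.1 := by
      by_contra hc; exact hne (by rw [hx _ (by omega), zero_mul])
    have hj : -N ≤ ij.2 := by
      by_contra hc; exact hne (by rw [hy _ (by omega), mul_zero])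
    rw [Finset.mem_Icc]; omega
  · intro a ha _ b hb _ hab
    have h1 := (Finset.mem_antidiagonal.1 ha).2.2
    have h2 := (Finset.mem_antidiagonal.1 hb).2.2
    ext
    · exact hab
    · omega
  · intro i _ hne
    refine ⟨(i, n - i), Finset.mem_antidiagonal.2 ⟨?_, ?_, by simp⟩, hne, rfl⟩
    · exact fun h0 => hne (by rw [h0, zero_mul])
    · exact fun h0 => hne (by rw [h0, mul_zero])
  · intro ij h _
    have h1 := (Finset.mem_antidiagonal.1 h).2.2
    rw [← h1]; simp

theorem laurent_exists_bound {T : Type*} [CommRing T] (x : LaurentSeries T) :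
    ∃ N : ℤ, ∀ i < -N, x.coeff i = 0 :=
  ⟨-x.order, fun i hi => HahnSeries.coeff_eq_zero_of_lt_order (by simpa using hi)⟩

/-- The ring homomorphism `T((z)) → T'((z))` applying `f` to the coefficients. -/
def laurentMap {T T' : Type*} [CommRing T] [CommRing T'] (f : T →+* T') :
    LaurentSeries T →+* LaurentSeries T' where
  toFun x := HahnSeries.map x f
  map_one' := by
    ext i
    simp only [HahnSeries.map_coeff, HahnSeries.coeff_one]
    split_ifs <;> simp
  map_zero' := by ext i; simp
  map_mul' x y := HahnSeries.map_mul (f : T →ₙ+* T')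
  map_add' x y := by ext i; simp

@[simp] theorem laurentMap_coeff {T T' : Type*} [CommRing T] [CommRing T'] (f : T →+* T')
    (x : LaurentSeries T) (i : ℤ) : (laurentMap f x).coeff i = f (x.coeff i) := rfl


/-! ## The ring `R⟦z, z⁻¹}` -/

section Rig

variable {Fε : Type u} {K : Type v} [Field Fε] [Fintype Fε] [NontriviallyNormedField K]
  [IsUltrametricDist K] [Algebra Fε (ValRing K)] (S : BaseDatum Fε K)

namespace BaseDatum

theorem norm_pos : 0 < ‖S.ζ‖ := norm_pos_iff.2 S.ζ_ne_zero

theorem norm_lt_one : ‖S.ζ‖ < 1 := (mem_maximalIdeal_iff _).1 S.ζ_mem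

end BaseDatum

/-- The convergence condition `|b_i| |ζ|^{r i} → 0` for `i → -∞`, for all `r > 0`, on the
coefficients of a series `∑_{i ∈ ℤ} b_i z^i` with `b_i ∈ R`. -/
def IsRig (b : ℤ → ValRing K) : Prop :=
  ∀ r : ℝ, 0 < r → Tendsto (fun i : ℤ => ‖b i‖ * ‖S.ζ‖ ^ (r * (i : ℝ))) atBot (𝓝 0)

theorem isRig_iff (b : ℤ → ValRing K) : IsRig S b ↔
    ∀ r : ℝ, 0 < r → ∃ c : ℝ, 0 ≤ c ∧ ∀ i : ℤ, ‖b i‖ * ‖S.ζ‖ ^ (r * (i : ℝ)) ≤ c := by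
  have hp := S.norm_pos
  have hl := S.norm_lt_one
  constructor
  · intro h r hr
    have h1 := (h r hr).eventually (ge_mem_nhds (zero_lt_one))
    obtain ⟨N, hN⟩ := eventually_atBot.1 h1
    refine ⟨max 1 (‖S.ζ‖ ^ (r * (N : ℝ))), le_max_of_le_left zero_le_one, fun i => ?_⟩
    rcases le_total i N with hi | hi
    · exact le_max_of_le_left (hN i hi)
    · refine le_max_of_le_right ?_
      calc ‖b i‖ * ‖S.ζ‖ ^ (r * (i : ℝ)) ≤ 1 * ‖S.ζ‖ ^ (r * (N : ℝ)) := by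
            refine mul_le_mul (norm_le_one _) ?_ (by positivity) zero_le_one
            refine Real.rpow_le_rpow_of_exponent_ge hp hl.le ?_
            have : (N : ℝ) ≤ i := by exact_mod_cast hi
            nlinarith
        _ = _ := one_mul _
  · intro h r hr
    obtain ⟨c, hc, hb⟩ := h (r + 1) (by linarith)
    have h2 : Tendsto (fun i : ℤ => c * ‖S.ζ‖ ^ (-(i : ℝ))) atBot (𝓝 (c * 0)) := by
      refine Tendsto.const_mul c ?_
      refine (tendsto_rpow_atTop_of_base_lt_one _ (by linarith) hl).comp ?_
      exact tendsto_neg_atBot_atTop.comp (tendsto_intCast_atBot_iff.2 tendsto_id)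
    rw [mul_zero] at h2
    refine squeeze_zero (fun i => by positivity) (fun i => ?_) h2
    calc ‖b i‖ * ‖S.ζ‖ ^ (r * (i : ℝ))
        = (‖b i‖ * ‖S.ζ‖ ^ ((r + 1) * (i : ℝ))) * ‖S.ζ‖ ^ (-(i : ℝ)) := by
          rw [mul_assoc, ← Real.rpow_add hp]; ring_nf
      _ ≤ _ := mul_le_mul_of_nonneg_right (hb i) (by positivity)

theorem IsRig.tendsto_atBot {S : BaseDatum Fε K} {b : ℤ → ValRing K} (h : IsRig S b) :
    Tendsto (fun i : ℤ => ‖b i‖) atBot (𝓝 0) := by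
  have h1 := h 1 one_pos
  refine squeeze_zero' (Eventually.of_forall fun i => norm_nonneg _) ?_ h1
  filter_upwards [eventually_le_atBot (0 : ℤ)] with i hi
  refine le_mul_of_one_le_right (norm_nonneg _) ?_
  refine Real.one_le_rpow_of_pos_of_le_one_of_nonpos S.norm_pos S.norm_lt_one.le ?_
  have : (i : ℝ) ≤ 0 := by exact_mod_cast hi
  linarith

/-- The additive group underlying `R⟦z, z⁻¹}`. -/
def rigAddSubgroup : AddSubgroup (ℤ → ValRing K) where
  carrier := {b | IsRig S b}
  zero_mem' r _ := by simp
  add_mem' {a b} ha hb r hr := by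
    refine squeeze_zero (fun i => by have := S.norm_pos; positivity) (fun i => ?_)
      (by simpa using (ha r hr).add (hb r hr))
    rw [← add_mul]
    exact mul_le_mul_of_nonneg_right (norm_add_le _ _) (by have := S.norm_pos; positivity)
  neg_mem' {a} ha r hr := by simpa using ha r hr

/-- The ring `R⟦z, z⁻¹}` of Laurent series `∑_{i ∈ ℤ} b_i z^i` with `b_i ∈ R` which converge on the
punctured open unit disc. -/
def Rig : Type v := rigAddSubgroup S

namespace Rig

variable {S}

instance : AddCommGroup (Rig S) := inferInstanceAs (AddCommGroup (rigAddSubgroup S))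

/-- The coefficient `b_i` of `∑_{i ∈ ℤ} b_i z^i`. -/
def coeff (f : Rig S) : ℤ → ValRing K := f.1

theorem isRig (f : Rig S) : IsRig S f.coeff := f.2

theorem ext {f g : Rig S} (h : ∀ i, f.coeff i = g.coeff i) : f = g :=
  Subtype.ext (funext h)

@[simp] theorem coeff_zero (i : ℤ) : (0 : Rig S).coeff i = 0 := rfl
@[simp] theorem coeff_add (f g : Rig S) (i : ℤ) : (f + g).coeff i = f.coeff i + g.coeff i := rfl

theorem tendsto_mul (f g : Rig S) (n : ℤ) :
    Tendsto (fun i => f.coeff i * g.coeff (n - i)) cofinite (𝓝 0) := by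
  rw [Int.cofinite_eq, tendsto_sup]
  constructor
  · exact squeeze_zero_norm (fun i => norm_mul_le_left _ _) f.isRig.tendsto_atBot
  · refine squeeze_zero_norm (fun i => norm_mul_le_right _ _) (g.isRig.tendsto_atBot.comp ?_)
    exact tendsto_atBot_add_const_left _ n tendsto_neg_atTop_atBot

instance : One (Rig S) where
  one := ⟨fun i => if i = 0 then 1 else 0, (isRig_iff S _).2 fun r _ => ⟨1, zero_le_one, fun i => by
    by_cases hi : i = 0 <;> simp [hi]⟩⟩

theorem coeff_one (i : ℤ) : (1 : Rig S).coeff i = if i = 0 then 1 else 0 := rfl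

variable [CompleteSpace K]

theorem summable_mul (f g : Rig S) (n : ℤ) :
    Summable (fun i => f.coeff i * g.coeff (n - i)) :=
  NonarchimedeanAddGroup.summable_of_tendsto_cofinite_zero (tendsto_mul f g n)

/-- Multiplication in `R⟦z, z⁻¹}`: the `n`-th coefficient of `f g` is the convergent sum
`∑_{i ∈ ℤ} f_i g_{n - i}` in `R`. -/
instance : Mul (Rig S) where
  mul f g := ⟨fun n => ∑' i : ℤ, f.coeff i * g.coeff (n - i), (isRig_iff S _).2 fun r hr => by
    have hp := S.norm_pos
    obtain ⟨c, hc, hf⟩ := (isRig_iff S _).1 f.isRig r hr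
    obtain ⟨d, hd, hg⟩ := (isRig_iff S _).1 g.isRig r hr
    refine ⟨c * d, mul_nonneg hc hd, fun n => ?_⟩
    have hn : 0 < ‖S.ζ‖ ^ (r * (n : ℝ)) := by positivity
    rw [← le_div_iff₀ hn]
    refine IsUltrametricDist.norm_tsum_le_of_forall_le_of_nonneg (by positivity) fun i => ?_
    rw [le_div_iff₀ hn, norm_mul']
    calc ‖f.coeff i‖ * ‖g.coeff (n - i)‖ * ‖S.ζ‖ ^ (r * (n : ℝ))
        = (‖f.coeff i‖ * ‖S.ζ‖ ^ (r * (i : ℝ))) *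
          (‖g.coeff (n - i)‖ * ‖S.ζ‖ ^ (r * ((n - i : ℤ) : ℝ))) := by
            have : r * (n : ℝ) = r * i + r * ((n - i : ℤ) : ℝ) := by push_cast; ring
            rw [this, Real.rpow_add hp]; ring
      _ ≤ c * d := mul_le_mul (hf i) (hg _) (by positivity) hc⟩

theorem coeff_mul (f g : Rig S) (n : ℤ) :
    (f * g).coeff n = ∑' i : ℤ, f.coeff i * g.coeff (n - i) := rfl

theorem mul_comm' (f g : Rig S) : f * g = g * f := by
  refine Rig.ext fun n => ?_
  rw [coeff_mul, coeff_mul, ← (Equiv.subLeft n).tsum_eq (fun i => f.coeff i * g.coeff (n - i))]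
  refine tsum_congr fun i => ?_
  simp [mul_comm]

theorem one_mul' (f : Rig S) : 1 * f = f := by
  refine Rig.ext fun n => ?_
  rw [coeff_mul, tsum_eq_single 0]
  · simp [coeff_one]
  · intro i hi; simp [coeff_one, hi]

theorem add_mul' (f g h : Rig S) : (f + g) * h = f * h + g * h := by
  refine Rig.ext fun n => ?_
  rw [coeff_add, coeff_mul, coeff_mul, coeff_mul,
    ← (summable_mul f h n).tsum_add (summable_mul g h n)]
  simp [add_mul]

theorem summable_mul₃ (f g h : Rig S) (n : ℤ) :
    Summable (fun p : ℤ × ℤ => f.coeff p.1 * g.coeff p.2 * h.coeff (n - p.1 - p.2)) := by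
  refine NonarchimedeanAddGroup.summable_of_tendsto_cofinite_zero ?_
  rw [tendsto_zero_iff_norm_tendsto_zero, Metric.tendsto_nhds]
  intro ε hε
  have key : ∀ b : Rig S, ∃ N : ℤ, ∀ i ≤ N, ‖b.coeff i‖ < ε := fun b =>
    eventually_atBot.1 (b.isRig.tendsto_atBot.eventually (gt_mem_nhds hε))
  obtain ⟨N₁, h₁⟩ := key f
  obtain ⟨N₂, h₂⟩ := key g
  obtain ⟨N₃, h₃⟩ := key h
  rw [eventually_cofinite]
  refine ((Set.finite_Icc N₁ (n - N₂ - N₃)).prod (Set.finite_Icc N₂ (n - N₁ - N₃))).subset ?_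
  rintro ⟨i, j⟩ hij
  simp only [Real.dist_eq, sub_zero, abs_norm, not_lt, Set.mem_ofPred_eq] at hij
  have a₁ : N₁ < i := by
    by_contra hc
    have := (norm_mul_le_left (f.coeff i * g.coeff j) (h.coeff (n - i - j))).trans
      (norm_mul_le_left (f.coeff i) (g.coeff j))
    linarith [h₁ i (by omega)]
  have a₂ : N₂ < j := by
    by_contra hc
    have := (norm_mul_le_left (f.coeff i * g.coeff j) (h.coeff (n - i - j))).trans
      (norm_mul_le_right (f.coeff i) (g.coeff j))
    linarith [h₂ j (by omega)]
  have a₃ : N₃ < n - i - j := by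
    by_contra hc
    have := norm_mul_le_right (f.coeff i * g.coeff j) (h.coeff (n - i - j))
    linarith [h₃ (n - i - j) (by omega)]
  simp only [Set.mem_prod, Set.mem_Icc]
  omega

/-- The change of summation indices `(m, i) ↦ (i, m - i)`. -/
def shear : (ℤ × ℤ) ≃ (ℤ × ℤ) where
  toFun p := (p.2, p.1 - p.2)
  invFun p := (p.1 + p.2, p.1)
  left_inv p := by ext <;> simp
  right_inv p := by ext <;> simp

theorem mul_assoc' (f g h : Rig S) : f * g * h = f * (g * h) := by
  refine Rig.ext fun n => ?_
  have hs := summable_mul₃ f g h n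
  have h1 : (f * g * h).coeff n =
      ∑' p : ℤ × ℤ, f.coeff (shear p).1 * g.coeff (shear p).2 *
        h.coeff (n - (shear p).1 - (shear p).2) := by
    have hs' : Summable fun p : ℤ × ℤ => f.coeff (shear p).1 * g.coeff (shear p).2 *
        h.coeff (n - (shear p).1 - (shear p).2) := shear.summable_iff.2 hs
    rw [hs'.tsum_prod, coeff_mul]
    refine tsum_congr fun m => ?_
    rw [coeff_mul, ← (summable_mul f g m).tsum_mul_right]
    refine tsum_congr fun i => ?_
    have : n - i - (m - i) = n - m := by ring
    simp [shear, this]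
  have h2 : (f * (g * h)).coeff n =
      ∑' p : ℤ × ℤ, f.coeff p.1 * g.coeff p.2 * h.coeff (n - p.1 - p.2) := by
    rw [hs.tsum_prod, coeff_mul]
    refine tsum_congr fun i => ?_
    rw [coeff_mul, ← (summable_mul g h (n - i)).tsum_mul_left]
    exact tsum_congr fun j => (mul_assoc _ _ _).symm
  rw [h1, h2]
  exact shear.tsum_eq
    (fun p : ℤ × ℤ => f.coeff p.1 * g.coeff p.2 * h.coeff (n - p.1 - p.2))

instance : CommRing (Rig S) where
  mul_assoc := mul_assoc'
  one_mul := one_mul'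
  mul_one f := by rw [mul_comm', one_mul']
  zero_mul f := Rig.ext fun n => by rw [coeff_mul]; simp
  mul_zero f := Rig.ext fun n => by rw [coeff_mul]; simp
  left_distrib f g h := by rw [mul_comm', add_mul', mul_comm' g, mul_comm' h]
  right_distrib := add_mul'
  mul_comm := mul_comm'
  zsmul := fun n f => n • f
  neg_add_cancel := neg_add_cancel
  nsmul := fun n f => n • f
  sub_eq_add_neg := sub_eq_add_neg
  nsmul_zero := AddMonoid.nsmul_zero
  nsmul_succ := AddMonoid.nsmul_succ
  zsmul_zero' := SubNegMonoid.zsmul_zero'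
  zsmul_succ' := SubNegMonoid.zsmul_succ'
  zsmul_neg' := SubNegMonoid.zsmul_neg'

/-- A Laurent series with coefficients in `R`, as an element of `R⟦z, z⁻¹}`. -/
def ofLaurent : LaurentSeries (ValRing K) →+* Rig S where
  toFun x := ⟨x.coeff, fun r _ => by
    obtain ⟨N, hN⟩ := laurent_exists_bound x
    refine tendsto_const_nhds.congr' ?_
    filter_upwards [eventually_lt_atBot (-N)] with i hi
    rw [hN i hi, norm_zero, zero_mul]⟩
  map_one' := Rig.ext fun n => by
    change (1 : LaurentSeries (ValRing K)).coeff n = (1 : Rig S).coeff n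
    rw [coeff_one, HahnSeries.coeff_one]
    split_ifs <;> rfl
  map_zero' := rfl
  map_add' x y := rfl
  map_mul' x y := Rig.ext fun n => by
    obtain ⟨N₁, h₁⟩ := laurent_exists_bound x
    obtain ⟨N₂, h₂⟩ := laurent_exists_bound y
    have hx : ∀ i < -(max N₁ N₂), x.coeff i = 0 := fun i hi => h₁ i (by omega)
    have hy : ∀ i < -(max N₁ N₂), y.coeff i = 0 := fun i hi => h₂ i (by omega)
    change (x * y).coeff n = ∑' i : ℤ, x.coeff i * y.coeff (n - i)
    rw [laurent_coeff_mul x y _ n hx hy, tsum_eq_sum]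
    intro i hi
    rw [Finset.mem_Icc, not_and_or] at hi
    rcases hi with hi | hi
    · rw [hx i (by omega), zero_mul]
    · rw [hy (n - i) (by omega), mul_zero]

@[simp] theorem ofLaurent_coeff (x : LaurentSeries (ValRing K)) (i : ℤ) :
    (ofLaurent x : Rig S).coeff i = x.coeff i := rfl

theorem hasSum_mul (f g : Rig S) (n : ℤ) :
    HasSum (fun i => f.coeff i * g.coeff (n - i)) ((f * g).coeff n) :=
  (summable_mul f g n).hasSum

/-- The endomorphism `σ̂` of `R⟦z, z⁻¹}` with `σ̂(z) = z` and `σ̂(b) = b^q̂` for `b ∈ R`. -/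
def frob : Rig S →+* Rig S where
  toFun f := ⟨fun i => FiniteField.frobeniusAlgHom Fε (ValRing K) (f.coeff i), by
    have hq : Fintype.card Fε ≠ 0 := Fintype.card_ne_zero
    refine (isRig_iff S _).2 fun r hr => ?_
    obtain ⟨c, hc, hb⟩ := (isRig_iff S _).1 f.isRig r hr
    refine ⟨c, hc, fun i => le_trans (mul_le_mul_of_nonneg_right ?_ ?_) (hb i)⟩
    · rw [FiniteField.frobeniusAlgHom_apply, norm_pow']
      exact pow_le_of_le_one (norm_nonneg _) (norm_le_one _) hq
    · have := S.norm_pos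
      positivity⟩
  map_one' := Rig.ext fun n => by
    change FiniteField.frobeniusAlgHom Fε (ValRing K) ((1 : Rig S).coeff n) = (1 : Rig S).coeff n
    rw [coeff_one]
    split_ifs
    · exact map_one _
    · exact map_zero _
  map_zero' := Rig.ext fun n => map_zero (FiniteField.frobeniusAlgHom Fε (ValRing K))
  map_add' f g := Rig.ext fun n => map_add (FiniteField.frobeniusAlgHom Fε (ValRing K)) _ _
  map_mul' f g := Rig.ext fun n => by
    have hc : Continuous (FiniteField.frobeniusAlgHom Fε (ValRing K)) := by
      rw [FiniteField.coe_frobeniusAlgHom]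
      exact continuous_pow _
    have h := (hasSum_mul f g n).map (FiniteField.frobeniusAlgHom Fε (ValRing K)) hc
    refine h.unique (HasSum.congr_fun (hasSum_mul _ _ n) fun i => ?_)
    exact map_mul (FiniteField.frobeniusAlgHom Fε (ValRing K)) _ _

@[simp] theorem frob_coeff (f : Rig S) (i : ℤ) :
    (frob f).coeff i = FiniteField.frobeniusAlgHom Fε (ValRing K) (f.coeff i) := rfl

theorem exists_residue_eq_zero (f : Rig S) :
    ∃ N : ℤ, ∀ i < -N, IsLocalRing.residue (ValRing K) (f.coeff i) = 0 := by
  obtain ⟨N, hN⟩ := eventually_atBot.1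
    (f.isRig.tendsto_atBot.eventually (gt_mem_nhds (zero_lt_one)))
  refine ⟨-N, fun i hi => ?_⟩
  rw [IsLocalRing.residue_eq_zero_iff, mem_maximalIdeal_iff]
  exact hN i (by omega)

/-- The reduction `R⟦z, z⁻¹} → k((z))` modulo `𝔪_R`. -/
def reduce : Rig S →+* LaurentSeries (ResField K) where
  toFun f := HahnSeries.ofSuppBddBelow (fun i => IsLocalRing.residue (ValRing K) (f.coeff i)) (by
    obtain ⟨N, hN⟩ := exists_residue_eq_zero f
    refine ⟨-N, fun i hi => ?_⟩
    by_contra hc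
    exact hi (hN i (by omega)))
  map_one' := by
    ext i
    rw [HahnSeries.coeff_ofSuppBddBelow, coeff_one, HahnSeries.coeff_one]
    split_ifs <;> simp
  map_zero' := by
    ext i
    simp
  map_add' f g := by
    ext i
    simp
  map_mul' f g := by
    ext n
    obtain ⟨N₁, h₁⟩ := exists_residue_eq_zero f
    obtain ⟨N₂, h₂⟩ := exists_residue_eq_zero g
    rw [laurent_coeff_mul _ _ (max N₁ N₂) n (fun i hi => h₁ i (by omega))
      (fun i hi => h₂ i (by omega))]
    simp only [HahnSeries.coeff_ofSuppBddBelow]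
    have h := (hasSum_mul f g n).eventually
      (Metric.ball_mem_nhds ((f * g).coeff n) zero_lt_one)
    obtain ⟨s, hs⟩ := eventually_atTop.1 h
    have h3 := hs (s ∪ Finset.Icc (-(max N₁ N₂)) (n + max N₁ N₂)) Finset.subset_union_left
    rw [dist_eq_norm, ← mem_maximalIdeal_iff,
      ← IsLocalRing.residue_eq_zero_iff, map_sub, sub_eq_zero] at h3
    rw [← h3, map_sum]
    simp only [map_mul]
    refine (Finset.sum_subset Finset.subset_union_right fun i _ hi => ?_).symm
    rw [Finset.mem_Icc, not_and_or] at hi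
    rcases hi with hi | hi
    · rw [h₁ i (by omega), zero_mul]
    · rw [h₂ (n - i) (by omega), mul_zero]

@[simp] theorem reduce_coeff (f : Rig S) (i : ℤ) :
    (reduce f).coeff i = IsLocalRing.residue (ValRing K) (f.coeff i) := rfl

/-! ### Expansion at `z = ζ` -/

/-- The `i`-th summand `binom(i, j) b_i ζ^{i - j}` of the `j`-th Taylor coefficient at `z = ζ`. -/
def term (f : Rig S) (j : ℕ) (i : ℤ) : K :=
  ((Ring.choose i j : ℤ) : K) * (f.coeff i : K) * (S.ζ : K) ^ (i - (j : ℤ))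

theorem norm_term_le (f : Rig S) (j : ℕ) (i : ℤ) :
    ‖f.term j i‖ ≤ ‖f.coeff i‖ * ‖S.ζ‖ ^ (i - (j : ℤ)) := by
  rw [term, norm_mul, norm_mul, norm_zpow]
  refine mul_le_mul_of_nonneg_right ?_ (by positivity)
  exact mul_le_of_le_one_left (norm_nonneg _) (IsUltrametricDist.norm_intCast_le_one K _)

theorem tendsto_term (f : Rig S) (j : ℕ) : Tendsto (f.term j) cofinite (𝓝 0) := by
  have hp := S.norm_pos
  have hz : (‖S.ζ‖ : ℝ) ≠ 0 := hp.ne'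
  rw [Int.cofinite_eq, tendsto_sup]
  constructor
  · have h := (f.isRig 1 one_pos).mul_const (‖S.ζ‖ ^ (-(j : ℤ)))
    rw [zero_mul] at h
    refine squeeze_zero_norm (fun i => (norm_term_le f j i).trans_eq ?_) h
    rw [one_mul, Real.rpow_intCast, mul_assoc, ← zpow_add₀ hz, sub_eq_add_neg]
  · have h : Tendsto (fun i : ℤ => ‖S.ζ‖ ^ i * ‖S.ζ‖ ^ (-(j : ℤ))) atTop (𝓝 0) := by
      have h1 : Tendsto (fun i : ℤ => ‖S.ζ‖ ^ (i : ℝ)) atTop (𝓝 0) :=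
        (tendsto_rpow_atTop_of_base_lt_one _ (by linarith) S.norm_lt_one).comp
          (tendsto_intCast_atTop_iff.2 tendsto_id)
      simp only [Real.rpow_intCast] at h1
      simpa using h1.mul_const (‖S.ζ‖ ^ (-(j : ℤ)))
    refine squeeze_zero_norm (fun i => (norm_term_le f j i).trans ?_) h
    rw [← zpow_add₀ hz, sub_eq_add_neg]
    exact mul_le_of_le_one_left (by positivity) (norm_le_one _)

theorem summable_term (f : Rig S) (j : ℕ) : Summable (f.term j) :=
  NonarchimedeanAddGroup.summable_of_tendsto_cofinite_zero (tendsto_term f j)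

theorem term_one (j : ℕ) (i : ℤ) :
    (1 : Rig S).term j i = if i = 0 then (if j = 0 then 1 else 0) else 0 := by
  rw [term, coeff_one]
  by_cases hi : i = 0
  · subst hi
    rw [if_pos rfl, if_pos rfl, Ring.choose_zero_ite]
    by_cases hj : j = 0 <;> simp [hj]
  · simp [hi]

theorem sum_term_mul_term (f g : Rig S) (j : ℕ) (i l : ℤ) :
    ∑ p ∈ Finset.HasAntidiagonal.antidiagonal j, f.term p.1 i * g.term p.2 l =
      ((Ring.choose (i + l) j : ℤ) : K) * ((f.coeff i * g.coeff l : ValRing K) : K) *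
        (S.ζ : K) ^ (i + l - (j : ℤ)) := by
  have hz : (S.ζ : K) ≠ 0 := fun h => S.ζ_ne_zero (Subtype.ext h)
  rw [Ring.add_choose_eq j (Commute.all i l), Int.cast_sum, Finset.sum_mul, Finset.sum_mul]
  refine Finset.sum_congr rfl fun p hp => ?_
  have hp' : (j : ℤ) = p.1 + p.2 := by
    rw [← Finset.HasAntidiagonal.mem_antidiagonal.1 hp]; push_cast; rfl
  have : i + l - (j : ℤ) = (i - p.1) + (l - p.2) := by rw [hp']; ring
  rw [term, term, this, zpow_add₀ hz, Int.cast_mul]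
  push_cast
  ring

/-- The ring homomorphism `R⟦z, z⁻¹} → K⟦z - ζ⟧`,
`∑_i b_i z^i ↦ ∑_j (∑_i binom(i, j) b_i ζ^{i - j}) (z - ζ)^j`.
The variable of the power series ring over `K` is `z - ζ`. -/
def expand : Rig S →+* PowerSeries K where
  toFun f := PowerSeries.mk fun j => ∑' i : ℤ, f.term j i
  map_one' := by
    ext j
    rw [PowerSeries.coeff_mk, tsum_congr (term_one j), tsum_ite_eq, PowerSeries.coeff_one]
  map_zero' := by
    ext j
    simp [term]
  map_add' f g := by
    ext j
    rw [map_add, PowerSeries.coeff_mk, PowerSeries.coeff_mk, PowerSeries.coeff_mk,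
      ← (summable_term f j).tsum_add (summable_term g j)]
    refine tsum_congr fun i => ?_
    simp [term, mul_add, add_mul]
  map_mul' f g := by
    ext j
    have hsum : ∀ p : ℕ × ℕ, Summable fun x : ℤ × ℤ => f.term p.1 x.1 * g.term p.2 x.2 :=
      fun p => (summable_term f p.1).mul_of_nonarchimedean (summable_term g p.2)
    rw [PowerSeries.coeff_mul, PowerSeries.coeff_mk]
    simp only [PowerSeries.coeff_mk]
    have h1 : ∀ p ∈ Finset.HasAntidiagonal.antidiagonal j, (∑' i, f.term p.1 i) * (∑' l, g.term p.2 l) =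
        ∑' x : ℤ × ℤ, f.term p.1 x.1 * g.term p.2 x.2 := fun p _ =>
      tsum_mul_tsum_of_nonarchimedean (summable_term f p.1) (summable_term g p.2)
    rw [Finset.sum_congr rfl h1, ← Summable.tsum_finsetSum fun p _ => hsum p]
    simp only [sum_term_mul_term]
    have hs : Summable fun x : ℤ × ℤ => ((Ring.choose (x.1 + x.2) j : ℤ) : K) *
        ((f.coeff x.1 * g.coeff x.2 : ValRing K) : K) * (S.ζ : K) ^ (x.1 + x.2 - (j : ℤ)) := by
      simp only [← sum_term_mul_term]
      exact summable_sum fun p _ => hsum p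
    have hs' : Summable fun x : ℤ × ℤ => ((Ring.choose ((shear x).1 + (shear x).2) j : ℤ) : K) *
        ((f.coeff (shear x).1 * g.coeff (shear x).2 : ValRing K) : K) *
        (S.ζ : K) ^ ((shear x).1 + (shear x).2 - (j : ℤ)) := shear.summable_iff.2 hs
    rw [← shear.tsum_eq (fun x : ℤ × ℤ => ((Ring.choose (x.1 + x.2) j : ℤ) : K) *
        ((f.coeff x.1 * g.coeff x.2 : ValRing K) : K) * (S.ζ : K) ^ (x.1 + x.2 - (j : ℤ))),
      hs'.tsum_prod]
    refine tsum_congr fun n => ?_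
    have h2 : HasSum (fun i => ((f.coeff i * g.coeff (n - i) : ValRing K) : K))
        (((f * g).coeff n : ValRing K) : K) :=
      (hasSum_mul f g n).map (ValRing K).subtype continuous_subtype_val
    have h3 := (h2.mul_left ((Ring.choose n j : ℤ) : K)).mul_right ((S.ζ : K) ^ (n - (j : ℤ)))
    rw [term, ← h3.tsum_eq]
    refine tsum_congr fun i => ?_
    simp [shear]

theorem coeff_expand (f : Rig S) (j : ℕ) :
    PowerSeries.coeff j (expand f) = ∑' i : ℤ, f.term j i := by
  change PowerSeries.coeff j (PowerSeries.mk fun j : ℕ => ∑' i : ℤ, f.term j i) = _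
  rw [PowerSeries.coeff_mk]


/-! ### The element `ℓ₋` -/

/-- The partial products `∏_{i < N} (1 - ζ^{q̂^i} T)` of `ℓ₋`, where `T = z⁻¹`. -/
def ellPartial (S : BaseDatum Fε K) (N : ℕ) : PowerSeries (ValRing K) :=
  ∏ i ∈ Finset.range N,
    (1 - PowerSeries.C (S.ζ ^ Fintype.card Fε ^ i) * PowerSeries.X)

/-- The coefficient of `z^{-n}` in `ℓ₋`, a limit in `R`. -/
def ellCoeff (S : BaseDatum Fε K) (n : ℕ) : ValRing K :=
  limUnder atTop fun N => PowerSeries.coeff n (ellPartial S N)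

theorem ellPartial_succ' (S : BaseDatum Fε K) (N : ℕ) :
    ellPartial S (N + 1) = (1 - PowerSeries.C S.ζ * PowerSeries.X) *
      PowerSeries.map (FiniteField.frobeniusAlgHom Fε (ValRing K)).toRingHom (ellPartial S N) := by
  rw [ellPartial, Finset.prod_range_succ', mul_comm, ellPartial, map_prod]
  congr 1
  · simp
  · refine Finset.prod_congr rfl fun i _ => ?_
    rw [map_sub, map_one, map_mul, PowerSeries.map_C, PowerSeries.map_X, pow_succ, pow_mul]
    rfl

theorem coeff_one_sub_mul (a : ValRing K) (p : PowerSeries (ValRing K)) (n : ℕ) :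
    PowerSeries.coeff (n + 1) ((1 - PowerSeries.C a * PowerSeries.X) * p) =
      PowerSeries.coeff (n + 1) p - a * PowerSeries.coeff n p := by
  rw [sub_mul, one_mul, mul_assoc, map_sub, PowerSeries.coeff_C_mul, PowerSeries.coeff_succ_X_mul]

theorem coeff_zero_ellPartial (S : BaseDatum Fε K) (N : ℕ) :
    PowerSeries.coeff 0 (ellPartial S N) = 1 := by
  rw [PowerSeries.coeff_zero_eq_constantCoeff_apply, ellPartial, map_prod]
  refine Finset.prod_eq_one fun i _ => ?_
  simp

theorem coeff_succ_ellPartial (S : BaseDatum Fε K) (N n : ℕ) :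
    PowerSeries.coeff (n + 1) (ellPartial S (N + 1)) =
      PowerSeries.coeff (n + 1) (ellPartial S N) ^ Fintype.card Fε -
        S.ζ * PowerSeries.coeff n (ellPartial S N) ^ Fintype.card Fε := by
  rw [ellPartial_succ', coeff_one_sub_mul]
  rfl

theorem le_choose (n : ℕ) : n ≤ (n + 1).choose 2 := by
  rw [Nat.choose_succ_succ, Nat.choose_one_right]; exact Nat.le_add_right _ _

theorem norm_coeff_ellPartial_le (S : BaseDatum Fε K) (N n : ℕ) :
    ‖PowerSeries.coeff n (ellPartial S N)‖ ≤ ‖S.ζ‖ ^ (n + 1).choose 2 := by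
  have hp := S.norm_pos
  have hl := S.norm_lt_one.le
  have hq : 2 ≤ Fintype.card Fε := Fintype.one_lt_card
  induction N generalizing n with
  | zero =>
    rcases n with _ | n
    · rw [coeff_zero_ellPartial]; simp
    · simp [ellPartial, PowerSeries.coeff_one]
  | succ N ih =>
    rcases n with _ | n
    · rw [coeff_zero_ellPartial]; simp
    · rw [coeff_succ_ellPartial]
      rw [sub_eq_add_neg]
      refine (IsUltrametricDist.norm_add_le_max _ _).trans (max_le ?_ ?_)
      · rw [norm_pow']
        exact (pow_le_of_le_one (norm_nonneg _) (norm_le_one _) (by omega)).trans (ih (n + 1))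
      · rw [norm_neg, norm_mul', norm_pow']
        calc ‖S.ζ‖ * ‖PowerSeries.coeff n (ellPartial S N)‖ ^ Fintype.card Fε
            ≤ ‖S.ζ‖ * (‖S.ζ‖ ^ (n + 1).choose 2) ^ 2 := by
              refine mul_le_mul_of_nonneg_left ?_ hp.le
              refine (pow_le_pow_of_le_one (norm_nonneg _) (norm_le_one _) hq).trans ?_
              exact pow_le_pow_left₀ (norm_nonneg _) (ih n) 2
          _ = ‖S.ζ‖ ^ (1 + (n + 1).choose 2 * 2) := by rw [pow_add, pow_one, pow_mul]
          _ ≤ _ := by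
              refine pow_le_pow_of_le_one hp.le hl ?_
              have h1 := le_choose n
              have h2 : (n + 1 + 1).choose 2 = (n + 1) + (n + 1).choose 2 := by
                rw [Nat.choose_succ_succ (n + 1), Nat.choose_one_right]
              omega

theorem tendsto_ellCoeff (S : BaseDatum Fε K) (n : ℕ) :
    Tendsto (fun N => PowerSeries.coeff n (ellPartial S N)) atTop (𝓝 (ellCoeff S n)) := by
  have hq : 1 < Fintype.card Fε := Fintype.one_lt_card
  have hc : CauchySeq fun N => PowerSeries.coeff n (ellPartial S N) := by
    refine cauchySeq_of_le_geometric ‖S.ζ‖ 1 S.norm_lt_one fun N => ?_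
    rcases n with _ | n
    · rw [coeff_zero_ellPartial, coeff_zero_ellPartial, dist_self]
      have := S.norm_pos
      positivity
    · have h1 : ellPartial S (N + 1) = (1 - PowerSeries.C (S.ζ ^ Fintype.card Fε ^ N) *
          PowerSeries.X) * ellPartial S N := by
        rw [ellPartial, Finset.prod_range_succ, mul_comm, ellPartial]
      rw [h1, coeff_one_sub_mul, dist_eq_norm, sub_sub_cancel, one_mul]
      refine (norm_mul_le_left _ _).trans ?_
      rw [norm_pow']
      exact pow_le_pow_of_le_one (norm_nonneg _) (norm_le_one _) (Nat.lt_pow_self hq).le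
  exact hc.tendsto_limUnder

theorem norm_ellCoeff_le (S : BaseDatum Fε K) (n : ℕ) :
    ‖ellCoeff S n‖ ≤ ‖S.ζ‖ ^ (n + 1).choose 2 :=
  le_of_tendsto (tendsto_ellCoeff S n).norm
    (Eventually.of_forall fun N => norm_coeff_ellPartial_le S N n)

theorem ellCoeff_zero (S : BaseDatum Fε K) : ellCoeff S 0 = 1 := by
  refine tendsto_nhds_unique (tendsto_ellCoeff S 0) ?_
  simp only [coeff_zero_ellPartial]
  exact tendsto_const_nhds

theorem ellCoeff_succ (S : BaseDatum Fε K) (n : ℕ) :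
    ellCoeff S (n + 1) = ellCoeff S (n + 1) ^ Fintype.card Fε -
      S.ζ * ellCoeff S n ^ Fintype.card Fε := by
  refine tendsto_nhds_unique ((tendsto_ellCoeff S (n + 1)).comp (tendsto_add_atTop_nat 1)) ?_
  refine (((tendsto_ellCoeff S (n + 1)).pow _).sub
    (((tendsto_ellCoeff S n).pow _).const_mul S.ζ)).congr fun N => ?_
  exact (coeff_succ_ellPartial S N n).symm

/-- The element `ℓ₋ = ∏_{i ≥ 0} (1 - ζ^{q̂^i} / z)` of `R⟦z, z⁻¹}`. -/
def ell (S : BaseDatum Fε K) : Rig S :=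
  ⟨fun i => if i ≤ 0 then ellCoeff S i.natAbs else 0, (isRig_iff S _).2 fun r hr => by
    have hp := S.norm_pos
    have hl := S.norm_lt_one.le
    refine ⟨‖S.ζ‖ ^ (-(r ^ 2)), by positivity, fun i => ?_⟩
    split_ifs with hi
    · obtain ⟨n, rfl⟩ : ∃ n : ℕ, i = -n := ⟨i.natAbs, by omega⟩
      rw [Int.natAbs_neg, Int.natAbs_natCast]
      have h2 : (2 : ℝ) * ((n + 1).choose 2 : ℕ) = n * (n + 1) := by
        rw [Nat.cast_choose_two]; push_cast; ring
      calc ‖ellCoeff S n‖ * ‖S.ζ‖ ^ (r * ((-(n : ℤ) : ℤ) : ℝ))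
          ≤ ‖S.ζ‖ ^ (n + 1).choose 2 * ‖S.ζ‖ ^ (r * ((-(n : ℤ) : ℤ) : ℝ)) :=
            mul_le_mul_of_nonneg_right (norm_ellCoeff_le S n) (by positivity)
        _ = ‖S.ζ‖ ^ ((((n + 1).choose 2 : ℕ) : ℝ) + r * ((-(n : ℤ) : ℤ) : ℝ)) := by
            rw [Real.rpow_add hp, Real.rpow_natCast]
        _ ≤ _ := by
            refine Real.rpow_le_rpow_of_exponent_ge hp hl ?_
            push_cast
            nlinarith [sq_nonneg ((n : ℝ) - r), sq_nonneg r, (Nat.cast_nonneg n : (0 : ℝ) ≤ n)]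
    · rw [norm_zero, zero_mul]; positivity⟩

theorem ell_coeff (S : BaseDatum Fε K) (i : ℤ) :
    (ell S).coeff i = if i ≤ 0 then ellCoeff S i.natAbs else 0 := rfl

theorem coeff_single_mul (m : ℤ) (a : ValRing K) (f : Rig S) (n : ℤ) :
    (ofLaurent (HahnSeries.single m a) * f).coeff n = a * f.coeff (n - m) := by
  rw [coeff_mul, tsum_eq_single m]
  · simp
  · intro i hi
    simp [HahnSeries.coeff_single_of_ne hi]

/-- `z - ζ` in `R((z))`. -/
def zSubZeta (S : BaseDatum Fε K) : LaurentSeries (ValRing K) :=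
  HahnSeries.single 1 1 - HahnSeries.single 0 S.ζ

/-- `ℓ₋ = (1 - ζ / z) σ̂(ℓ₋)`. -/
theorem z_mul_ell (S : BaseDatum Fε K) :
    ofLaurent (HahnSeries.single 1 1) * ell S = ofLaurent (zSubZeta S) * frob (ell S) := by
  refine Rig.ext fun n => ?_
  rw [zSubZeta, map_sub, sub_mul]
  have hsub : ∀ f g : Rig S, (f - g).coeff n = f.coeff n - g.coeff n := fun _ _ => rfl
  rw [hsub, coeff_single_mul, coeff_single_mul, coeff_single_mul, one_mul, one_mul, sub_zero,
    frob_coeff, frob_coeff, ell_coeff, ell_coeff, FiniteField.frobeniusAlgHom_apply,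
    FiniteField.frobeniusAlgHom_apply]
  have hq : Fintype.card Fε ≠ 0 := Fintype.card_ne_zero
  by_cases h1 : n - 1 ≤ 0
  · rw [if_pos h1]
    by_cases h2 : n ≤ 0
    · rw [if_pos h2]
      have : (n - 1).natAbs = n.natAbs + 1 := by omega
      rw [this]
      exact ellCoeff_succ S _
    · have : n = 1 := by omega
      subst this
      simp [ellCoeff_zero, hq]
  · rw [if_neg h1, if_neg (by omega)]
    simp [hq]

theorem reduce_ell (S : BaseDatum Fε K) : reduce (ell S) = 1 := by
  ext i
  rw [reduce_coeff, HahnSeries.coeff_one, ell_coeff]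
  by_cases h : i = 0
  · subst h
    simp [ellCoeff_zero]
  · rw [if_neg h]
    split_ifs with hi
    · rw [IsLocalRing.residue_eq_zero_iff, mem_maximalIdeal_iff]
      refine (norm_ellCoeff_le S _).trans_lt (pow_lt_one₀ S.norm_pos.le S.norm_lt_one ?_)
      have := le_choose i.natAbs
      omega
    · exact map_zero _

theorem expand_single (m : ℤ) (a : ValRing K) (j : ℕ) :
    PowerSeries.coeff j (expand (ofLaurent (HahnSeries.single m a) : Rig S)) =
      ((Ring.choose m j : ℤ) : K) * (a : K) * (S.ζ : K) ^ (m - (j : ℤ)) := by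
  rw [coeff_expand, tsum_eq_single m]
  · simp [term]
  · intro i hi
    simp [term, HahnSeries.coeff_single_of_ne hi]

theorem expand_zSubZeta (S : BaseDatum Fε K) :
    expand (ofLaurent (zSubZeta S) : Rig S) = PowerSeries.X := by
  have hz : (S.ζ : K) ≠ 0 := fun h => S.ζ_ne_zero (Subtype.ext h)
  ext j
  rw [zSubZeta, map_sub, map_sub, map_sub, expand_single, expand_single, PowerSeries.coeff_X]
  rcases j with _ | _ | j
  · simp
  · simp
  · have h1 : Ring.choose (1 : ℤ) (j + 1 + 1) = 0 := by
      have := Ring.choose_natCast (R := ℤ) 1 (j + 1 + 1)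
      rw [Nat.choose_eq_zero_of_lt (by omega)] at this
      simpa using this
    simp [h1]

theorem isUnit_expand_frob_ell (S : BaseDatum Fε K) : IsUnit (expand (frob (ell S))) := by
  have hp := S.norm_pos
  have hl := S.norm_lt_one
  have hq : 2 ≤ Fintype.card Fε := Fintype.one_lt_card
  rw [PowerSeries.isUnit_iff_constantCoeff, isUnit_iff_ne_zero,
    ← PowerSeries.coeff_zero_eq_constantCoeff_apply, coeff_expand]
  have h0 : (frob (ell S)).term 0 0 = 1 := by
    simp [term, ell_coeff, ellCoeff_zero]
  have hs := summable_term (frob (ell S)) 0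
  have hle : ‖∑' i : ℤ, ((frob (ell S)).term 0 i - if i = 0 then 1 else 0)‖ ≤ ‖S.ζ‖ := by
    refine IsUltrametricDist.norm_tsum_le_of_forall_le_of_nonneg hp.le fun i => ?_
    by_cases hi : i = 0
    · subst hi
      rw [if_pos rfl, h0, sub_self, norm_zero]
      exact hp.le
    · rw [if_neg hi, sub_zero]
      refine (norm_term_le _ _ _).trans ?_
      rw [frob_coeff, FiniteField.frobeniusAlgHom_apply, norm_pow', ell_coeff]
      split_ifs with h
      · obtain ⟨n, rfl⟩ : ∃ n : ℕ, i = -n := ⟨i.natAbs, by omega⟩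
        rw [Int.natAbs_neg, Int.natAbs_natCast, Nat.cast_zero, sub_zero]
        have hn : 1 ≤ n := by omega
        have h2 : (n + 1).choose 2 * 2 = n * n + n := by
          rw [Nat.choose_two_right, Nat.add_sub_cancel,
            Nat.div_mul_cancel (by rw [mul_comm]; exact (Nat.even_mul_succ_self n).two_dvd)]
          ring
        calc ‖ellCoeff S n‖ ^ Fintype.card Fε * ‖S.ζ‖ ^ (-(n : ℤ))
            ≤ (‖S.ζ‖ ^ (n + 1).choose 2) ^ 2 * ‖S.ζ‖ ^ (-(n : ℤ)) := by
              refine mul_le_mul_of_nonneg_right ?_ (by positivity)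
              refine (pow_le_pow_of_le_one (norm_nonneg _) (norm_le_one _) hq).trans ?_
              exact pow_le_pow_left₀ (norm_nonneg _) (norm_ellCoeff_le S n) 2
          _ = ‖S.ζ‖ ^ (n * n) := by
              rw [← pow_mul, h2, pow_add, zpow_neg, zpow_natCast, mul_assoc,
                mul_inv_cancel₀ (pow_ne_zero _ hp.ne'), mul_one]
          _ ≤ ‖S.ζ‖ := pow_le_of_le_one hp.le hl.le (by positivity)
      · simp
  intro hz
  rw [hs.tsum_sub (hasSum_ite_eq 0 (1 : K)).summable, tsum_ite_eq, hz, zero_sub, norm_neg,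
    norm_one] at hle
  linarith

end Rig

end Rig

/-! ## Rings and ring homomorphisms attached to the base datum -/

section Rings

variable {Fε : Type u} {K : Type v} [Field Fε] [Fintype Fε] [NontriviallyNormedField K]
  [IsUltrametricDist K] [Algebra Fε (ValRing K)] (S : BaseDatum Fε K)

/-- The inclusion `T⟦z⟧ → T((z))`. -/
abbrev coeL (T : Type*) [CommRing T] : PowerSeries T →+* LaurentSeries T :=
  HahnSeries.ofPowerSeries ℤ T

namespace BaseDatum

/-- The `q̂`-Frobenius of `R`. -/
def σR (_S : BaseDatum Fε K) : ValRing K →+* ValRing K :=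
  (FiniteField.frobeniusAlgHom Fε (ValRing K)).toRingHom

/-- The `q̂`-Frobenius of `k`. -/
def σres (_S : BaseDatum Fε K) : ResField K →+* ResField K :=
  (FiniteField.frobeniusAlgHom Fε (ResField K)).toRingHom

/-- The endomorphism `σ̂` of `R⟦z⟧` with `σ̂(z) = z` and `σ̂(b) = b^q̂` for `b ∈ R`. -/
def σP : PowerSeries (ValRing K) →+* PowerSeries (ValRing K) := PowerSeries.map S.σR

/-- The endomorphism `σ̂` of `R((z))`. -/
def σL : LaurentSeries (ValRing K) →+* LaurentSeries (ValRing K) := laurentMap S.σR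

/-- The endomorphism `σ̂` of `k((z))`. -/
def σk : LaurentSeries (ResField K) →+* LaurentSeries (ResField K) := laurentMap S.σres

/-- The element `z - ζ` of `R⟦z⟧`. -/
def zz : PowerSeries (ValRing K) := PowerSeries.X - PowerSeries.C S.ζ

/-- The ring `R⟦z⟧[1/(z - ζ)]`. -/
abbrev Pz : Type v := Localization.Away S.zz

/-- The ring `R((z))[1/(z - ζ)]`. -/
abbrev Lz : Type v := Localization.Away (coeL (ValRing K) S.zz)

/-- The reduction `R((z)) → k((z))`. -/
def πL (_S : BaseDatum Fε K) : LaurentSeries (ValRing K) →+* LaurentSeries (ResField K) :=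
  laurentMap (IsLocalRing.residue (ValRing K))

/-- The reduction `R⟦z⟧ → k((z))`. -/
abbrev π : PowerSeries (ValRing K) →+* LaurentSeries (ResField K) := S.πL.comp (coeL (ValRing K))

theorem laurentMap_comp_coeL {T T' : Type*} [CommRing T] [CommRing T'] (f : T →+* T') :
    (laurentMap f).comp (coeL T) = (coeL T').comp (PowerSeries.map f) := by
  refine RingHom.ext fun p => HahnSeries.ext (funext fun i => ?_)
  change f ((p : LaurentSeries T).coeff i) =
    ((PowerSeries.map f p : PowerSeries T') : LaurentSeries T').coeff i
  rw [PowerSeries.coeff_coe, PowerSeries.coeff_coe]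
  split_ifs
  · exact map_zero f
  · exact (PowerSeries.coeff_map f _ p).symm

theorem laurentMap_comp {T T' T'' : Type*} [CommRing T] [CommRing T'] [CommRing T'']
    (f : T →+* T') (g : T' →+* T'') :
    (laurentMap g).comp (laurentMap f) = laurentMap (g.comp f) := rfl

theorem residue_comp_σR :
    (IsLocalRing.residue (ValRing K)).comp S.σR = S.σres.comp (IsLocalRing.residue (ValRing K)) :=
  RingHom.ext fun x => map_pow (IsLocalRing.residue (ValRing K)) x (Fintype.card Fε)

theorem σR_comp_sec : S.σR.comp S.sec = S.sec.comp S.σres :=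
  RingHom.ext fun x => (map_pow S.sec x (Fintype.card Fε)).symm

theorem σL_comp_coeL : S.σL.comp (coeL (ValRing K)) = (coeL (ValRing K)).comp S.σP :=
  laurentMap_comp_coeL S.σR

theorem coeL_zz : coeL (ValRing K) S.zz = Rig.zSubZeta S := by
  rw [zz, map_sub, HahnSeries.ofPowerSeries_X, HahnSeries.ofPowerSeries_C]
  rfl

theorem isUnit_single_one (T : Type*) [CommRing T] :
    IsUnit (HahnSeries.single 1 1 : LaurentSeries T) :=
  IsUnit.of_mul_eq_one (HahnSeries.single (-1) 1) (by
    rw [HahnSeries.single_mul_single]; simp)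

theorem πL_comp_σL : S.πL.comp S.σL = S.σk.comp S.πL := by
  rw [πL, σL, σk, laurentMap_comp, laurentMap_comp, residue_comp_σR]

theorem π_comp_σP : S.π.comp S.σP = S.σk.comp S.π := by
  rw [π, RingHom.comp_assoc, ← σL_comp_coeL, ← RingHom.comp_assoc, πL_comp_σL,
    RingHom.comp_assoc]

theorem isUnit_π_zz : IsUnit (S.π S.zz) := by
  change IsUnit (S.πL (coeL (ValRing K) S.zz))
  rw [coeL_zz]
  convert isUnit_single_one (ResField K) using 1
  have h : IsLocalRing.residue (ValRing K) S.ζ = 0 :=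
    (IsLocalRing.residue_eq_zero_iff _).2 S.ζ_mem
  refine HahnSeries.ext (funext fun i => ?_)
  rw [πL, laurentMap_coeff, Rig.zSubZeta, HahnSeries.coeff_sub, map_sub]
  simp only [HahnSeries.coeff_single]
  split_ifs <;> simp [h]

variable [CompleteSpace K]

/-- The homomorphism `k((z)) → R⟦z, z⁻¹}` given by the section `k → R`. -/
def κ : LaurentSeries (ResField K) →+* Rig S := Rig.ofLaurent.comp (laurentMap S.sec)

/-- The ring `R⟦z, z⁻¹}[ℓ₋⁻¹]`. -/
abbrev E : Type v := Localization.Away (Rig.ell S)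

/-- The homomorphism `R((z)) → R⟦z, z⁻¹}[ℓ₋⁻¹]`. -/
def ιL : LaurentSeries (ValRing K) →+* S.E := (algebraMap (Rig S) S.E).comp Rig.ofLaurent

/-- The homomorphism `R⟦z⟧ → R⟦z, z⁻¹}[ℓ₋⁻¹]`. -/
abbrev ι : PowerSeries (ValRing K) →+* S.E := S.ιL.comp (coeL (ValRing K))

/-- The homomorphism `k((z)) → R⟦z, z⁻¹}[ℓ₋⁻¹]` given by the section `k → R`. -/
def κE : LaurentSeries (ResField K) →+* S.E := (algebraMap (Rig S) S.E).comp S.κ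

/-- The expansion `R((z)) → K⟦z - ζ⟧`. -/
def evL : LaurentSeries (ValRing K) →+* PowerSeries K :=
  (Rig.expand (S := S)).comp Rig.ofLaurent

/-- The expansion `R⟦z⟧ → K⟦z - ζ⟧`. -/
abbrev evP : PowerSeries (ValRing K) →+* PowerSeries K := S.evL.comp (coeL (ValRing K))

/-- The homomorphism `k((z)) → K⟦z - ζ⟧`, `z ↦ ζ + (z - ζ)`. -/
def evk : LaurentSeries (ResField K) →+* PowerSeries K := Rig.expand.comp S.κ

theorem frob_comp_ofLaurent :
    (Rig.frob (S := S)).comp Rig.ofLaurent = Rig.ofLaurent.comp S.σL := rfl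

theorem frob_comp_κ : (Rig.frob (S := S)).comp S.κ = S.κ.comp S.σk := by
  rw [κ, ← RingHom.comp_assoc, frob_comp_ofLaurent, RingHom.comp_assoc, RingHom.comp_assoc, σL, σk,
    laurentMap_comp, laurentMap_comp, σR_comp_sec]

theorem reduce_comp_ofLaurent : (Rig.reduce (S := S)).comp Rig.ofLaurent = S.πL := by
  refine RingHom.ext fun x => HahnSeries.ext (funext fun i => ?_)
  exact Rig.reduce_coeff (S := S) _ _

theorem reduce_comp_κ :
    (Rig.reduce (S := S)).comp S.κ = RingHom.id (LaurentSeries (ResField K)) := by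
  rw [κ, ← RingHom.comp_assoc, reduce_comp_ofLaurent, πL, laurentMap_comp,
    residue_comp_sec]
  rfl

theorem isUnit_ofLaurent_z : IsUnit (Rig.ofLaurent (HahnSeries.single 1 1) : Rig S) :=
  (isUnit_single_one (ValRing K)).map Rig.ofLaurent

theorem isUnit_algebraMap_ell : IsUnit (algebraMap (Rig S) S.E (Rig.ell S)) :=
  IsLocalization.Away.algebraMap_isUnit (Rig.ell S)

theorem isUnit_algebraMap_mul : IsUnit (algebraMap (Rig S) S.E
    (Rig.ofLaurent (Rig.zSubZeta S) * Rig.frob (Rig.ell S))) := by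
  rw [← Rig.z_mul_ell, map_mul]
  exact (S.isUnit_ofLaurent_z.map (algebraMap (Rig S) S.E)).mul S.isUnit_algebraMap_ell

theorem isUnit_frob_ell : IsUnit (algebraMap (Rig S) S.E (Rig.frob (Rig.ell S))) := by
  have h := S.isUnit_algebraMap_mul
  rw [map_mul] at h
  exact isUnit_of_mul_isUnit_right h

theorem isUnit_ιL_zz : IsUnit (S.ιL (coeL (ValRing K) S.zz)) := by
  have h := S.isUnit_algebraMap_mul
  rw [map_mul] at h
  rw [coeL_zz]
  exact isUnit_of_mul_isUnit_left h

/-- The endomorphism `σ̂` of `R⟦z, z⁻¹}[ℓ₋⁻¹]`. -/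
def σE : S.E →+* S.E :=
  IsLocalization.Away.lift (Rig.ell S) (g := (algebraMap (Rig S) S.E).comp Rig.frob)
    S.isUnit_frob_ell

theorem σE_comp_algebraMap :
    S.σE.comp (algebraMap (Rig S) S.E) = (algebraMap (Rig S) S.E).comp Rig.frob :=
  IsLocalization.Away.lift_comp _ _

/-- The reduction `R⟦z, z⁻¹}[ℓ₋⁻¹] → k((z))` modulo `𝔪_R`; it maps `ℓ₋` to `1`. -/
def redE : S.E →+* LaurentSeries (ResField K) :=
  IsLocalization.Away.lift (Rig.ell S) (g := Rig.reduce) (by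
    rw [Rig.reduce_ell]; exact isUnit_one)

theorem redE_comp_algebraMap : S.redE.comp (algebraMap (Rig S) S.E) = Rig.reduce :=
  IsLocalization.Away.lift_comp _ _

/-- The composition of `σ̂` with the expansion at `z = ζ`, as a homomorphism
`R⟦z, z⁻¹}[ℓ₋⁻¹] → K⟦z - ζ⟧`. It exists because `σ̂(ℓ₋)` does not vanish at `z = ζ`. -/
def evσ : S.E →+* PowerSeries K :=
  IsLocalization.Away.lift (Rig.ell S) (g := Rig.expand.comp Rig.frob)
    (Rig.isUnit_expand_frob_ell S)

theorem evσ_comp_algebraMap :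
    S.evσ.comp (algebraMap (Rig S) S.E) = Rig.expand.comp Rig.frob :=
  IsLocalization.Away.lift_comp _ _

theorem isUnit_ι_zz : IsUnit (S.ι S.zz) := S.isUnit_ιL_zz

theorem σE_comp_ιL : S.σE.comp S.ιL = S.ιL.comp S.σL := by
  rw [ιL, ← RingHom.comp_assoc, σE_comp_algebraMap]
  rfl

theorem σE_comp_ι : S.σE.comp S.ι = S.ι.comp S.σP := by
  rw [ι, ← RingHom.comp_assoc, σE_comp_ιL, RingHom.comp_assoc, RingHom.comp_assoc, σL_comp_coeL]

theorem σE_comp_κE : S.σE.comp S.κE = S.κE.comp S.σk := by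
  rw [κE, ← RingHom.comp_assoc, σE_comp_algebraMap, RingHom.comp_assoc, RingHom.comp_assoc,
    frob_comp_κ]

theorem redE_comp_ι : S.redE.comp S.ι = S.π := by
  rw [ι, ιL, ← RingHom.comp_assoc, ← RingHom.comp_assoc, redE_comp_algebraMap,
    reduce_comp_ofLaurent]

theorem redE_comp_κE : S.redE.comp S.κE = RingHom.id (LaurentSeries (ResField K)) := by
  rw [κE, ← RingHom.comp_assoc, redE_comp_algebraMap, reduce_comp_κ]

theorem evσ_comp_ι : S.evσ.comp S.ι = S.evP.comp S.σP := by
  rw [ι, ιL, ← RingHom.comp_assoc, ← RingHom.comp_assoc, evσ_comp_algebraMap, evP,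
    RingHom.comp_assoc S.σP, ← σL_comp_coeL]
  rfl

theorem evσ_comp_κE : S.evσ.comp S.κE = S.evk.comp S.σk := by
  rw [κE, ← RingHom.comp_assoc, evσ_comp_algebraMap, evk, RingHom.comp_assoc, frob_comp_κ,
    RingHom.comp_assoc]

theorem evP_zz : S.evP S.zz = PowerSeries.X := by
  change Rig.expand (Rig.ofLaurent (coeL (ValRing K) S.zz) : Rig S) = _
  rw [coeL_zz, Rig.expand_zSubZeta]

end BaseDatum

/-- The inclusion `K⟦z - ζ⟧ → K((z - ζ))`. -/
abbrev inclX (K : Type v) [Field K] : PowerSeries K →+* LaurentSeries K :=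
  algebraMap (PowerSeries K) (LaurentSeries K)

/-- The residue map `K⟦z - ζ⟧ → K`, evaluation at `z = ζ`. -/
abbrev ev0 (K : Type v) [Field K] : PowerSeries K →+* K := PowerSeries.constantCoeff

instance ev0_surjective (K : Type v) [Field K] : RingHomSurjective (ev0 K) :=
  ⟨PowerSeries.constantCoeff_surj⟩

theorem BaseDatum.isUnit_inclX_zz [CompleteSpace K] :
    IsUnit (((inclX K).comp S.evP) S.zz) := by
  rw [RingHom.comp_apply, S.evP_zz, isUnit_iff_ne_zero]
  refine fun h => PowerSeries.X_ne_zero (R := K) ?_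
  exact (map_eq_zero_iff _ (IsFractionRing.injective (PowerSeries K) (LaurentSeries K))).1 h

end Rings

/-! ## Local shtukas -/

section Shtuka

variable {Fε : Type u} {K : Type v} [Field Fε] [Fintype Fε] [NontriviallyNormedField K]
  [IsUltrametricDist K] [Algebra Fε (ValRing K)]

/-- A local shtuka over `R`: a finite free `R⟦z⟧`-module `M` together with an isomorphism
`τ : σ̂^*M[1/(z - ζ)] ≅ M[1/(z - ζ)]`. -/
structure LocalShtuka (S : BaseDatum Fε K) where
  carrier : Type w
  [addCommGroup : AddCommGroup carrier]
  [module : Module (PowerSeries (ValRing K)) carrier]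
  [free : Module.Free (PowerSeries (ValRing K)) carrier]
  [finite : Module.Finite (PowerSeries (ValRing K)) carrier]
  τ : BC (algebraMap (PowerSeries (ValRing K)) S.Pz) (BC S.σP carrier) ≃ₗ[S.Pz]
    BC (algebraMap (PowerSeries (ValRing K)) S.Pz) carrier

attribute [instance] LocalShtuka.addCommGroup LocalShtuka.module LocalShtuka.free
  LocalShtuka.finite

namespace LocalShtuka

variable {S : BaseDatum Fε K} (M : LocalShtuka.{u, v, w} S)

/-- The base change of `τ` along a homomorphism `φ : R⟦z⟧ → C` for which `φ(z - ζ)` is a unit. -/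
def tauAlong {C : Type*} [CommRing C] (φ : PowerSeries (ValRing K) →+* C)
    (hφ : IsUnit (φ S.zz)) : BC φ (BC S.σP M.carrier) ≃ₗ[C] BC φ M.carrier :=
  (BC.compEquiv (IsLocalization.Away.lift_comp S.zz hφ)).symm ≪≫ₗ
    BC.mapEquiv (IsLocalization.Away.lift S.zz hφ) M.τ ≪≫ₗ
    BC.compEquiv (IsLocalization.Away.lift_comp S.zz hφ)

/-- The `k((z))`-vector space `D̃ = M ⊗_{R⟦z⟧} k((z))`. -/
abbrev Dtilde : Type _ := BC S.π M.carrier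

/-- The Frobenius `τ_D̃ : σ̂^*D̃ ≅ D̃` obtained from `τ` by base change. -/
def tauDtilde : BC S.σk M.Dtilde ≃ₗ[LaurentSeries (ResField K)] M.Dtilde :=
  BC.swap S.π_comp_σP.symm ≪≫ₗ M.tauAlong S.π S.isUnit_π_zz

/-- The crystalline realization `D = H¹_cris(M, k((z))) = σ̂^*M ⊗_{R⟦z⟧} k((z))`. -/
abbrev Hcris : Type _ := BC S.π (BC S.σP M.carrier)

/-- The canonical identification `σ̂^*D̃ ≅ D`. -/
def sigmaDtilde : BC S.σk M.Dtilde ≃ₗ[LaurentSeries (ResField K)] M.Hcris :=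
  BC.swap S.π_comp_σP.symm

/-- The Frobenius `τ_D = σ̂^*τ_D̃ : σ̂^*D ≅ D` of the `z`-isocrystal
`(D, τ_D) = σ̂^*(M, τ) ⊗_{R⟦z⟧} k((z))`. -/
def tauD : BC S.σk M.Hcris ≃ₗ[LaurentSeries (ResField K)] M.Hcris :=
  BC.mapEquiv S.σk (M.sigmaDtilde.symm ≪≫ₗ M.tauDtilde) ≪≫ₗ M.sigmaDtilde

end LocalShtuka

variable [CompleteSpace K]

/-- A rigidified local shtuka over `R`: a local shtuka `(M, τ)` together with an isomorphism
`δ : M ⊗ R⟦z, z⁻¹}[ℓ₋⁻¹] ≅ D̃ ⊗_{k((z))} R⟦z, z⁻¹}[ℓ₋⁻¹]`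
satisfying `δ ∘ τ = τ_D̃ ∘ σ̂^*δ` and `δ ≡ id_D̃` modulo `𝔪_R`. -/
structure RigidifiedLocalShtuka (S : BaseDatum Fε K) extends LocalShtuka.{u, v, w} S where
  δ : BC S.ι carrier ≃ₗ[S.E] BC S.κE (BC S.π carrier)
  δ_comp_τ : ∀ x : BC S.ι (BC S.σP carrier),
    δ (toLocalShtuka.tauAlong S.ι S.isUnit_ι_zz x) =
      BC.map S.κE toLocalShtuka.tauDtilde.toLinearMap
        (BC.swap S.σE_comp_κE
          (BC.map S.σE δ.toLinearMap (BC.swap S.σE_comp_ι.symm x)))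
  δ_mod : ∀ x : BC S.redE (BC S.ι carrier),
    BC.cancel S.redE_comp_κE (BC.map S.redE δ.toLinearMap x) = BC.compEquiv S.redE_comp_ι x

/-! ### Hodge–Pink lattices and filtrations -/

section HodgePink

variable {A : Type*} [CommRing A] (ev : A →+* PowerSeries K) (D : Type*) [AddCommGroup D]
  [Module A D]

/-- The tautological lattice in `D ⊗_A K((z - ζ))`: the image of `D ⊗_A K⟦z - ζ⟧`. -/
def tautLattice : Submodule (PowerSeries K) (BC ((inclX K).comp ev) D) :=
  Submodule.span (PowerSeries K) (Set.range (BC.mk ((inclX K).comp ev)))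

variable {ev D}

/-- The lattice `(z - ζ)^i 𝔮` in `D ⊗_A K((z - ζ))`. -/
def shiftLattice (q : Submodule (PowerSeries K) (BC ((inclX K).comp ev) D)) (i : ℤ) :
    Submodule (PowerSeries K) (BC ((inclX K).comp ev) D) :=
  q.map (DistribSMul.toLinearMap (PowerSeries K) (BC ((inclX K).comp ev) D)
    (HahnSeries.single i 1 : LaurentSeries K))

/-- The Hodge–Pink filtration defined by a lattice `𝔮 ⊂ D ⊗_A K((z - ζ))`: with
`𝔭 = D ⊗_A K⟦z - ζ⟧`, the subspace `F^i` of `D ⊗_A K = 𝔭 / (z - ζ) 𝔭` is the image of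
`𝔭 ∩ (z - ζ)^i 𝔮`. -/
def hodgePinkFil {e : A →+* K} (he : (ev0 K).comp ev = e)
    (q : Submodule (PowerSeries K) (BC ((inclX K).comp ev) D)) (i : ℤ) :
    Submodule K (BC e D) :=
  Submodule.map (BC.push (f := ev) (M := D) (ev0 K) he)
    { carrier := {x : BC ev D |
        BC.push (f := ev) (M := D) (inclX K) rfl x ∈ shiftLattice q i}
      zero_mem' := by
        rw [Set.mem_ofPred_eq, map_zero]
        exact zero_mem _
      add_mem' := fun {x y} hx hy => by
        rw [Set.mem_ofPred_eq, map_add]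
        exact add_mem hx hy
      smul_mem' := fun a x hx => by
        rw [Set.mem_ofPred_eq, map_smulₛₗ, algebraMap_smul]
        exact Submodule.smul_mem _ a hx }

end HodgePink

namespace BaseDatum

variable (S : BaseDatum Fε K)

/-- The homomorphism `R((z)) → K`, `z ↦ ζ`. -/
abbrev evLK : LaurentSeries (ValRing K) →+* K := (ev0 K).comp S.evL

/-- The homomorphism `R⟦z⟧ → K`, `z ↦ ζ`. -/
abbrev evPK : PowerSeries (ValRing K) →+* K := S.evLK.comp (coeL (ValRing K))

/-- The homomorphism `k((z)) → K`, `z ↦ ζ`. -/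
abbrev evkK : LaurentSeries (ResField K) →+* K := (ev0 K).comp S.evk

theorem ev0_comp_evP : (ev0 K).comp S.evP = S.evPK := rfl

theorem evσK_comp_ι : ((ev0 K).comp S.evσ).comp S.ι = S.evPK.comp S.σP := by
  rw [RingHom.comp_assoc, evσ_comp_ι, ← RingHom.comp_assoc, ev0_comp_evP]

theorem evσK_comp_κE : ((ev0 K).comp S.evσ).comp S.κE = S.evkK.comp S.σk := by
  rw [RingHom.comp_assoc, evσ_comp_κE, ← RingHom.comp_assoc]

theorem evσX_comp_ι :
    ((inclX K).comp S.evσ).comp S.ι = ((inclX K).comp S.evP).comp S.σP := by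
  rw [RingHom.comp_assoc, evσ_comp_ι, ← RingHom.comp_assoc]

theorem evσX_comp_κE :
    ((inclX K).comp S.evσ).comp S.κE = ((inclX K).comp S.evk).comp S.σk := by
  rw [RingHom.comp_assoc, evσ_comp_κE, ← RingHom.comp_assoc]

end BaseDatum

namespace RigidifiedLocalShtuka

variable {S : BaseDatum Fε K} (M : RigidifiedLocalShtuka.{u, v, w} S)

/-- The base change of `σ̂^*δ` to a ring `C`. Here `α : R⟦z⟧ → C` and `β : k((z)) → C` are the
structure maps, and `φ : R⟦z, z⁻¹}[ℓ₋⁻¹] → C` plays the role of the composition of `σ̂` with a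
structure map of `C`. -/
def sigmaDelta {C : Type*} [CommRing C] {α : PowerSeries (ValRing K) →+* C}
    {β : LaurentSeries (ResField K) →+* C} (φ : S.E →+* C) (hα : φ.comp S.ι = α.comp S.σP)
    (hβ : φ.comp S.κE = β.comp S.σk) : BC α (BC S.σP M.carrier) →ₗ[C] BC β M.Hcris :=
  BC.map β M.sigmaDtilde.toLinearMap ∘ₗ (BC.swap hβ).toLinearMap ∘ₗ
    BC.map φ M.δ.toLinearMap ∘ₗ (BC.swap hα.symm).toLinearMap

/-! ### The de Rham realization -/

/-- The de Rham realization `H¹_dR(M, K⟦z - ζ⟧) = σ̂^*M ⊗_{R⟦z⟧} K⟦z - ζ⟧`. -/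
abbrev HdR : Type _ := BC S.evP (BC S.σP M.carrier)

/-- The de Rham realization `H¹_dR(M, K((z - ζ))) = σ̂^*M ⊗_{R⟦z⟧} K((z - ζ))`. -/
abbrev HdRX : Type _ := BC ((inclX K).comp S.evP) (BC S.σP M.carrier)

/-- The de Rham realization `H¹_dR(M, K) = σ̂^*M ⊗_{R⟦z⟧, z ↦ ζ} K`. -/
abbrev HdRK : Type _ := BC S.evPK (BC S.σP M.carrier)

/-- The Hodge–Pink lattice `𝔮 = τ⁻¹(M ⊗_{R⟦z⟧} K⟦z - ζ⟧)` in `H¹_dR(M, K((z - ζ)))`. -/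
def qdR : Submodule (PowerSeries K) M.HdRX :=
  (tautLattice S.evP M.carrier).map
    ((M.tauAlong ((inclX K).comp S.evP) S.isUnit_inclX_zz).symm.toLinearMap.restrictScalars
      (PowerSeries K))

/-- The Hodge–Pink filtration `F^i H¹_dR(M, K)`. -/
def filHdR (i : ℤ) : Submodule K M.HdRK := hodgePinkFil S.ev0_comp_evP M.qdR i

/-- The integral structure `H¹_dR(M, R) = σ̂^*M / (z - ζ) σ̂^*M`, as a submodule of `H¹_dR(M, K)`. -/
def HdRInt : Submodule (ValRing K) M.HdRK :=
  Submodule.span (ValRing K) (Set.range (BC.mk S.evPK))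

/-! ### The crystalline realization -/

/-- `H¹_cris(M, k((z))) ⊗_{k((z))} K⟦z - ζ⟧`. -/
abbrev HcrisEv : Type _ := BC S.evk M.Hcris

/-- `H¹_cris(M, k((z))) ⊗_{k((z))} K((z - ζ))`. -/
abbrev HcrisX : Type _ := BC ((inclX K).comp S.evk) M.Hcris

/-- `D_K = H¹_cris(M, k((z))) ⊗_{k((z)), z ↦ ζ} K`. -/
abbrev HcrisK : Type _ := BC S.evkK M.Hcris

/-- The Hodge–Pink lattice `𝔮_D = σ̂^*δ ∘ τ⁻¹ (M ⊗_{R⟦z⟧} K⟦z - ζ⟧)` in `D ⊗ K((z - ζ))`. -/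
def qD : Submodule (PowerSeries K) M.HcrisX :=
  (tautLattice S.evP M.carrier).map
    ((M.sigmaDelta ((inclX K).comp S.evσ) S.evσX_comp_ι S.evσX_comp_κE ∘ₗ
      (M.tauAlong ((inclX K).comp S.evP) S.isUnit_inclX_zz).symm.toLinearMap).restrictScalars
        (PowerSeries K))

/-- The Hodge–Pink filtration `F^i D_K`. -/
def filDK (i : ℤ) : Submodule K M.HcrisK := hodgePinkFil rfl M.qD i

/-- The integral structure `H¹_cris(M, k⟦z⟧) = σ̂^*M ⊗_{R⟦z⟧} k⟦z⟧`, as a submodule of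
`H¹_cris(M, k((z)))`. -/
def HcrisInt : Submodule (PowerSeries (ResField K)) M.Hcris :=
  Submodule.span (PowerSeries (ResField K)) (Set.range (BC.mk S.π))

/-- The `R`-submodule `H¹_cris(M, k⟦z⟧) ⊗_{k⟦z⟧, z ↦ ζ} R` of `D_K`. -/
def HcrisIntK : Submodule (ValRing K) M.HcrisK :=
  Submodule.span (ValRing K) (BC.mk S.evkK '' (M.HcrisInt : Set M.Hcris))

/-! ### The comparison homomorphisms -/

/-- `h_{dR,cris} = σ̂^*δ ⊗ id : H¹_dR(M, K⟦z - ζ⟧) → H¹_cris(M, k((z))) ⊗_{k((z))} K⟦z - ζ⟧`. -/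
def hdRcris : M.HdR →ₗ[PowerSeries K] M.HcrisEv :=
  M.sigmaDelta S.evσ S.evσ_comp_ι S.evσ_comp_κE

/-- `h_{dR,cris} = σ̂^*δ ⊗ id : H¹_dR(M, K) → H¹_cris(M, k((z))) ⊗_{k((z)), z ↦ ζ} K`. -/
def hdRcrisK : M.HdRK →ₗ[K] M.HcrisK :=
  M.sigmaDelta ((ev0 K).comp S.evσ) S.evσK_comp_ι S.evσK_comp_κE

/-- `h_{dR,cris} ⊗ id_{K((z - ζ))}`, for `h_{dR,cris}` over `K⟦z - ζ⟧`. -/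
def hdRcrisX : M.HdRX →ₗ[LaurentSeries K] M.HcrisX :=
  (BC.compEquiv rfl).toLinearMap ∘ₗ BC.map (inclX K) M.hdRcris ∘ₗ
    (BC.compEquiv rfl).symm.toLinearMap

/-- Reduction modulo `z - ζ`, `H¹_dR(M, K⟦z - ζ⟧) → H¹_dR(M, K)`. -/
def redHdR : M.HdR →ₛₗ[ev0 K] M.HdRK := BC.push (ev0 K) S.ev0_comp_evP

/-- Reduction modulo `z - ζ`, `D ⊗ K⟦z - ζ⟧ → D_K`. -/
def redHcris : M.HcrisEv →ₛₗ[ev0 K] M.HcrisK := BC.push (ev0 K) rfl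

end RigidifiedLocalShtuka

/-! ### Quasi-morphisms -/

/-- The base change along `ρ : R((z)) → C` of an `R((z))`-linear map `X[1/z] → Y[1/z]`. -/
def along {X Y : Type*} [AddCommGroup X] [Module (PowerSeries (ValRing K)) X] [AddCommGroup Y]
    [Module (PowerSeries (ValRing K)) Y] {C : Type*} [CommRing C]
    (ρ : LaurentSeries (ValRing K) →+* C)
    (g : BC (coeL (ValRing K)) X →ₗ[LaurentSeries (ValRing K)] BC (coeL (ValRing K)) Y) :
    BC (ρ.comp (coeL (ValRing K))) X →ₗ[C] BC (ρ.comp (coeL (ValRing K))) Y :=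
  (BC.compEquiv rfl).toLinearMap ∘ₗ BC.map ρ g ∘ₗ (BC.compEquiv rfl).symm.toLinearMap

/-- The pullback `σ̂^*f : σ̂^*X[1/z] → σ̂^*Y[1/z]` of an `R((z))`-linear map `f : X[1/z] → Y[1/z]`. -/
def sigmaPull (S : BaseDatum Fε K) {X Y : Type*} [AddCommGroup X]
    [Module (PowerSeries (ValRing K)) X] [AddCommGroup Y] [Module (PowerSeries (ValRing K)) Y]
    (f : BC (coeL (ValRing K)) X →ₗ[LaurentSeries (ValRing K)] BC (coeL (ValRing K)) Y) :
    BC (coeL (ValRing K)) (BC S.σP X) →ₗ[LaurentSeries (ValRing K)]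
      BC (coeL (ValRing K)) (BC S.σP Y) :=
  (BC.swap S.σL_comp_coeL).toLinearMap ∘ₗ BC.map S.σL f ∘ₗ
    (BC.swap S.σL_comp_coeL.symm).toLinearMap

theorem BaseDatum.isUnit_Lz_zz (S : BaseDatum Fε K) :
    IsUnit ((algebraMap (LaurentSeries (ValRing K)) S.Lz).comp (coeL (ValRing K)) S.zz) :=
  IsLocalization.Away.algebraMap_isUnit (coeL (ValRing K) S.zz)

/-- A quasi-morphism `M → N` of rigidified local shtukas: an `R((z))`-linear map
`f : M[1/z] → N[1/z]` with `τ_N ∘ σ̂^*f = f ∘ τ_M` (over `R((z))[1/(z - ζ)]`), which is compatible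
with the rigidifications. The morphisms of rigidified local shtukas are the quasi-morphisms which
map `M` into `N`. -/
structure QuasiHom {S : BaseDatum Fε K} (M N : RigidifiedLocalShtuka.{u, v, w} S) where
  f : BC (coeL (ValRing K)) M.carrier →ₗ[LaurentSeries (ValRing K)]
    BC (coeL (ValRing K)) N.carrier
  comm : ∀ x, N.tauAlong _ S.isUnit_Lz_zz
      (along (algebraMap (LaurentSeries (ValRing K)) S.Lz) (sigmaPull S f) x) =
    along (algebraMap (LaurentSeries (ValRing K)) S.Lz) f (M.tauAlong _ S.isUnit_Lz_zz x)
  rig : ∀ x : BC S.ι M.carrier,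
    N.δ (along S.ιL f x) = BC.map S.κE (along S.πL f) (M.δ x)

namespace QuasiHom

variable {S : BaseDatum Fε K} {M N : RigidifiedLocalShtuka.{u, v, w} S} (f : QuasiHom M N)

/-- The map `H¹_dR(f, K⟦z - ζ⟧)` induced by a quasi-morphism `f`. -/
def dRMap : M.HdR →ₗ[PowerSeries K] N.HdR := along S.evL (sigmaPull S f.f)

/-- The map `H¹_dR(f, K)` induced by a quasi-morphism `f`. -/
def dRMapK : M.HdRK →ₗ[K] N.HdRK := along S.evLK (sigmaPull S f.f)

/-- The map `H¹_cris(f, k((z)))` induced by a quasi-morphism `f`. -/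
def crisMap : M.Hcris →ₗ[LaurentSeries (ResField K)] N.Hcris := along S.πL (sigmaPull S f.f)

end QuasiHom

end Shtuka

end LocSht

end

/-!
Everything in the first part of the theorem is formal. For a ring `C` with structure maps
`α : R⟦z⟧ → C` and `β : k((z)) → C` and a homomorphism `φ : R⟦z, z⁻¹}[ℓ₋⁻¹] → C` which is compatible
with `α ∘ σ̂` and `β ∘ σ̂`, the base change `M.sigmaDelta φ` of `σ̂^*δ` to `C` is an isomorphism, since
`δ` is one, and it commutes with further base change `C → C'` (`push_sigmaDelta`). Applied to
`K⟦z - ζ⟧ → K` this gives the compatibility of the two comparison isomorphisms, and applied to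
`K⟦z - ζ⟧ → K((z - ζ))` it identifies `h_{dR,cris} ⊗ id` with the map which defines `𝔮_D`, whence the
statements on lattices and filtrations. Functoriality (`QuasiHom.sigmaDelta_along`) is the pullback
under `σ̂` of the compatibility of a quasi-morphism with the rigidifications.

The integral structures are compared on an extension of the Carlitz module by the unit object,
`M = R⟦z⟧²` with `τ = [1, b; 0, z - ζ]` for some `b ∈ 𝔪_R`. A rigidification `[1, g / ℓ₋; 0, 1 / ℓ₋]`
corresponds to a solution `g` of `z g = σ̂(g) - b σ̂(ℓ₋)`, and this equation determines recursively the
coefficients of a solution `g = ∑_{m ≥ 1} g_m z^{-m}`. The upper right entry of `h_{dR,cris}` is the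
value of `σ̂(g) / σ̂(ℓ₋)` at `z = ζ`. For a constant `b` it equals `b - log(b)`, where `log` is the
logarithm of the Carlitz module, and it need not be integral. For `q̂ = 3`, `ζ = t^4` and `b = -t` one has `g_1 = t` and
`|g_m| ≤ |t|^{m(m+1)/2}`, so that the term `g_1^3 ζ^{-1} = t^{-1}` of `σ̂(g)(ζ)` has absolute value
greater than `1`, while all others are integral (`one_lt_norm_expand_frob_extSeries`). The image
of the second basis vector of `H¹_dR(M, R)` then lies outside the crystalline integral structure. The
field `K = 𝔽₃((t))` has all the required properties.
-/

/-! ### Base change -/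

namespace BC

universe u₁ u₂ u₃ u₄ u₅

variable {A : Type u₁} {B : Type u₂} {C : Type u₃} [CommRing A] [CommRing B] [CommRing C]
  {f : A →+* B} {M : Type u₄} [AddCommGroup M] [Module A M]
  {M' : Type u₅} [AddCommGroup M'] [Module A M']

theorem push_map (u : M →ₗ[A] M') (ψ : B →+* C) {e : A →+* C} (h : ψ.comp f = e)
    (x : BC f M) : push ψ h (map f u x) = map e u (push ψ h x) := by
  induction x using BC.induction with
  | h0 => simp only [map_zero]
  | hmk b m => simp only [map_smulₛₗ, RingHom.id_apply, map_mk, push_mk]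
  | hadd x y hx hy => simp only [map_add, hx, hy]

end BC

noncomputable section

open Filter Topology

namespace LocSht

section Comparison

variable {Fε : Type u} {K : Type v} [Field Fε] [Fintype Fε] [NontriviallyNormedField K]
  [IsUltrametricDist K] [Algebra Fε (ValRing K)] [CompleteSpace K] {S : BaseDatum Fε K}

/-! ### The comparison maps -/

namespace RigidifiedLocalShtuka

variable (M : RigidifiedLocalShtuka.{u, v, w} S)

section SigmaDelta

variable {C : Type*} [CommRing C] {α : PowerSeries (ValRing K) →+* C}
    {β : LaurentSeries (ResField K) →+* C} (φ : S.E →+* C) (hα : φ.comp S.ι = α.comp S.σP)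
    (hβ : φ.comp S.κE = β.comp S.σk)

theorem sigmaDelta_mk_mk (m : M.carrier) :
    M.sigmaDelta φ hα hβ (BC.mk α (BC.mk S.σP m)) =
      BC.map β M.sigmaDtilde.toLinearMap (BC.swap hβ (BC.mk φ (M.δ (BC.mk S.ι m)))) := by
  simp [sigmaDelta]

theorem sigmaDelta_bijective : Function.Bijective (M.sigmaDelta φ hα hβ) := by
  have h := (BC.swap (M := M.carrier) hα.symm ≪≫ₗ BC.mapEquiv φ M.δ ≪≫ₗ BC.swap hβ ≪≫ₗ
    BC.mapEquiv β M.sigmaDtilde).bijective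
  exact h

variable {C' : Type*} [CommRing C'] {α' : PowerSeries (ValRing K) →+* C'}
    {β' : LaurentSeries (ResField K) →+* C'} {φ' : S.E →+* C'}

/-- The base changes of `σ̂^*δ` to the rings over `R⟦z, z⁻¹}[ℓ₋⁻¹]` are compatible with each other:
this is the source of all compatibilities of `h_{dR,cris}`. -/
theorem push_sigmaDelta (ψ : C →+* C') (hψα : ψ.comp α = α') (hψβ : ψ.comp β = β')
    (hψφ : ψ.comp φ = φ') (hα' : φ'.comp S.ι = α'.comp S.σP)
    (hβ' : φ'.comp S.κE = β'.comp S.σk) (x : BC α (BC S.σP M.carrier)) :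
    BC.push ψ hψβ (M.sigmaDelta φ hα hβ x) = M.sigmaDelta φ' hα' hβ' (BC.push ψ hψα x) := by
  have key : ∀ w : BC S.κE (BC S.π M.carrier),
      BC.push ψ hψβ (BC.map β M.sigmaDtilde.toLinearMap (BC.swap hβ (BC.mk φ w))) =
        BC.map β' M.sigmaDtilde.toLinearMap (BC.swap hβ' (BC.mk φ' w)) := by
    intro w
    rw [BC.push_map]
    congr 1
    induction w using BC.induction with
    | h0 => simp only [map_zero]
    | hmk b d =>
      simp only [map_smulₛₗ, RingHom.id_apply, BC.swap_mk_mk, BC.push_mk, ← hψφ, RingHom.comp_apply]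
    | hadd x y hx hy => simp only [map_add, hx, hy]
  induction x using BC.induction with
  | h0 => simp only [map_zero]
  | hmk b y =>
    induction y using BC.induction with
    | h0 => simp only [map_zero, smul_zero]
    | hmk c m =>
      simp only [map_smulₛₗ, RingHom.id_apply, BC.push_mk, sigmaDelta_mk_mk, key]
    | hadd x y hx hy => simp only [map_add, smul_add, hx, hy]
  | hadd x y hx hy => simp only [map_add, hx, hy]

end SigmaDelta

theorem hdRcrisX_eq :
    M.hdRcrisX = M.sigmaDelta ((inclX K).comp S.evσ) S.evσX_comp_ι S.evσX_comp_κE := by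
  refine BC.ext_mk fun x => ?_
  have h := M.push_sigmaDelta S.evσ S.evσ_comp_ι S.evσ_comp_κE (inclX K) rfl rfl rfl
    S.evσX_comp_ι S.evσX_comp_κE (BC.mk S.evP x)
  rw [BC.push_mk] at h
  rw [← h]
  have h2 : ∀ y : BC S.evk M.Hcris, BC.compEquiv (e := (inclX K).comp S.evk) rfl
      (BC.mk (inclX K) y) = BC.push (inclX K) rfl y := by
    intro y
    induction y using BC.induction with
    | h0 => simp only [map_zero]
    | hmk b d => simp only [map_smulₛₗ, RingHom.id_apply, BC.compEquiv_mk_mk, BC.push_mk]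
    | hadd x y hx hy => simp only [map_add, hx, hy]
  rw [← h2]
  simp [hdRcrisX, hdRcris]

/-- The comparison map over `K((z - ζ))` extends the one over `K⟦z - ζ⟧`. -/
theorem hdRcrisX_push (x : M.HdR) :
    M.hdRcrisX (BC.push (inclX K) rfl x) = BC.push (inclX K) rfl (M.hdRcris x) := by
  rw [hdRcrisX_eq]
  exact (M.push_sigmaDelta S.evσ S.evσ_comp_ι S.evσ_comp_κE (inclX K) rfl rfl rfl
    S.evσX_comp_ι S.evσX_comp_κE x).symm

theorem hdRcrisX_injective : Function.Injective M.hdRcrisX := by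
  rw [hdRcrisX_eq]
  exact (M.sigmaDelta_bijective _ _ _).1

theorem hdRcrisK_redHdR (x : M.HdR) :
    M.hdRcrisK (M.redHdR x) = M.redHcris (M.hdRcris x) :=
  (M.push_sigmaDelta S.evσ S.evσ_comp_ι S.evσ_comp_κE (ev0 K) S.ev0_comp_evP rfl rfl
    S.evσK_comp_ι S.evσK_comp_κE x).symm

theorem map_hdRcrisX_qdR : M.qdR.map (M.hdRcrisX.restrictScalars (PowerSeries K)) = M.qD := by
  rw [hdRcrisX_eq, qdR, qD, ← Submodule.map_comp]
  rfl

theorem map_hdRcrisX_shiftLattice (i : ℤ) :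
    (shiftLattice M.qdR i).map (M.hdRcrisX.restrictScalars (PowerSeries K)) =
      shiftLattice M.qD i := by
  rw [← map_hdRcrisX_qdR, shiftLattice, shiftLattice, ← Submodule.map_comp, ← Submodule.map_comp]
  congr 1
  ext x
  exact map_smul M.hdRcrisX (HahnSeries.single i 1 : LaurentSeries K) x

theorem map_hdRcrisK_filHdR (i : ℤ) : (M.filHdR i).map M.hdRcrisK = M.filDK i := by
  have hmem : ∀ x : M.HdR, BC.push (inclX K) rfl (M.hdRcris x) ∈ shiftLattice M.qD i ↔
      BC.push (inclX K) rfl x ∈ shiftLattice M.qdR i := by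
    intro x
    rw [← hdRcrisX_push, ← map_hdRcrisX_shiftLattice]
    exact Function.Injective.mem_set_image (f := M.hdRcrisX) M.hdRcrisX_injective
  ext y
  constructor
  · rintro ⟨_, ⟨x, hx, rfl⟩, rfl⟩
    exact ⟨M.hdRcris x, (hmem x).2 hx, (M.hdRcrisK_redHdR x).symm⟩
  · rintro ⟨x', hx', rfl⟩
    obtain ⟨x, rfl⟩ := (M.sigmaDelta_bijective S.evσ S.evσ_comp_ι S.evσ_comp_κE).2 x'
    exact ⟨M.redHdR x, ⟨x, (hmem x).1 hx', rfl⟩, M.hdRcrisK_redHdR x⟩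

end RigidifiedLocalShtuka

/-! ### Functoriality -/

namespace QuasiHom

variable {M N : RigidifiedLocalShtuka.{u, v, w} S} (f : QuasiHom M N)

section Along

variable {X Y : Type*} [AddCommGroup X] [Module (PowerSeries (ValRing K)) X] [AddCommGroup Y]
  [Module (PowerSeries (ValRing K)) Y]
  (g : BC (coeL (ValRing K)) X →ₗ[LaurentSeries (ValRing K)] BC (coeL (ValRing K)) Y)

theorem along_mk {C : Type*} [CommRing C] (ρ : LaurentSeries (ValRing K) →+* C) (x : X) :
    along ρ g (BC.mk (ρ.comp (coeL (ValRing K))) x) =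
      BC.compEquiv rfl (BC.mk ρ (g (BC.mk (coeL (ValRing K)) x))) := by
  simp [along]

theorem sigmaPull_mk_mk (x : X) :
    sigmaPull S g (BC.mk (coeL (ValRing K)) (BC.mk S.σP x)) =
      BC.swap S.σL_comp_coeL (BC.mk S.σL (g (BC.mk (coeL (ValRing K)) x))) := by
  simp [sigmaPull]

end Along

/-- The base change of `σ̂^*f` is compatible with the base change of `σ̂^*δ`, over every ring `C` as
in `RigidifiedLocalShtuka.sigmaDelta`. -/
theorem sigmaDelta_along {C : Type*} [CommRing C] {ρ : LaurentSeries (ValRing K) →+* C}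
    {β : LaurentSeries (ResField K) →+* C} (φ : S.E →+* C) (hρ : φ.comp S.ιL = ρ.comp S.σL)
    (hα : φ.comp S.ι = (ρ.comp (coeL (ValRing K))).comp S.σP)
    (hβ : φ.comp S.κE = β.comp S.σk) (x : BC (ρ.comp (coeL (ValRing K))) (BC S.σP M.carrier)) :
    N.sigmaDelta φ hα hβ (along ρ (sigmaPull S f.f) x) =
      BC.map β f.crisMap (M.sigmaDelta φ hα hβ x) := by
  -- `σ̂^*δ` on `σ̂^*N[1/z]` is the pullback of `δ` on `N[1/z]`
  have h1 : ∀ y : BC (coeL (ValRing K)) N.carrier,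
      N.sigmaDelta φ hα hβ (BC.compEquiv rfl (BC.mk ρ (BC.swap S.σL_comp_coeL (BC.mk S.σL y)))) =
        BC.map β N.sigmaDtilde.toLinearMap (BC.swap hβ (BC.mk φ
          (N.δ (BC.compEquiv rfl (BC.mk S.ιL y))))) := by
    intro y
    induction y using BC.induction with
    | h0 => simp only [map_zero]
    | hmk b m =>
      have hb : ρ (S.σL b) = φ (S.ιL b) := (RingHom.congr_fun hρ b).symm
      simp only [map_smulₛₗ, RingHom.id_apply, BC.swap_mk_mk, BC.compEquiv_mk_mk, hb,
        RigidifiedLocalShtuka.sigmaDelta_mk_mk]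
    | hadd x y hx hy => simp only [map_add, hx, hy]
  -- reduction modulo `𝔪_R` commutes with the pullback by `σ̂`
  have h2 : ∀ y : BC (coeL (ValRing K)) N.carrier,
      N.sigmaDtilde (BC.mk S.σk (BC.compEquiv rfl (BC.mk S.πL y))) =
        BC.compEquiv rfl (BC.mk S.πL (BC.swap S.σL_comp_coeL (BC.mk S.σL y))) := by
    intro y
    induction y using BC.induction with
    | h0 => simp only [map_zero]
    | hmk b m =>
      have hb : S.σk (S.πL b) = S.πL (S.σL b) := (RingHom.congr_fun S.πL_comp_σL b).symm
      simp only [map_smulₛₗ, RingHom.id_apply, BC.swap_mk_mk, BC.compEquiv_mk_mk, hb,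
        LocalShtuka.sigmaDtilde]
    | hadd x y hx hy => simp only [map_add, hx, hy]
  -- the pullback of the map which `f` induces on `D̃` is the map which it induces on `D`
  have h3 : ∀ w : BC S.κE (BC S.π M.carrier),
      BC.map β N.sigmaDtilde.toLinearMap (BC.swap hβ (BC.mk φ
        (BC.map S.κE (along S.πL f.f) w))) =
      BC.map β f.crisMap (BC.map β M.sigmaDtilde.toLinearMap (BC.swap hβ (BC.mk φ w))) := by
    intro w
    induction w using BC.induction with
    | h0 => simp only [map_zero]
    | hmk b d =>
      simp only [map_smulₛₗ, RingHom.id_apply, BC.swap_mk_mk, BC.map_mk]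
      congr 2
      induction d using BC.induction with
      | h0 => simp only [map_zero]
      | hmk c m =>
        have hs : M.sigmaDtilde (BC.mk S.σk (BC.mk S.π m)) = BC.mk S.π (BC.mk S.σP m) :=
          BC.swap_mk_mk _ _
        have hc : f.crisMap (BC.mk S.π (BC.mk S.σP m)) = BC.compEquiv rfl (BC.mk S.πL
            (BC.swap S.σL_comp_coeL (BC.mk S.σL (f.f (BC.mk (coeL (ValRing K)) m))))) := by
          rw [← sigmaPull_mk_mk]
          exact along_mk _ _ _
        simp only [map_smulₛₗ, RingHom.id_apply, LinearEquiv.coe_coe, along_mk, h2, hs, hc]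
      | hadd x y hx hy => simp only [map_add, hx, hy]
    | hadd x y hx hy => simp only [map_add, hx, hy]
  induction x using BC.induction with
  | h0 => simp only [map_zero]
  | hmk b y =>
    induction y using BC.induction with
    | h0 => simp only [map_zero, smul_zero]
    | hmk c m =>
      simp only [map_smulₛₗ, RingHom.id_apply, along_mk, sigmaPull_mk_mk, h1,
        RigidifiedLocalShtuka.sigmaDelta_mk_mk, ← h3, ← f.rig]
    | hadd x y hx hy => simp only [map_add, smul_add, hx, hy]
  | hadd x y hx hy => simp only [map_add, hx, hy]

theorem evσ_comp_ιL : S.evσ.comp S.ιL = S.evL.comp S.σL := by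
  rw [BaseDatum.ιL, ← RingHom.comp_assoc, BaseDatum.evσ_comp_algebraMap, BaseDatum.evL]
  rfl

theorem hdRcris_dRMap (x : M.HdR) :
    N.hdRcris (f.dRMap x) = BC.map S.evk f.crisMap (M.hdRcris x) :=
  f.sigmaDelta_along S.evσ evσ_comp_ιL S.evσ_comp_ι S.evσ_comp_κE x

theorem hdRcrisK_dRMapK (x : M.HdRK) :
    N.hdRcrisK (f.dRMapK x) = BC.map S.evkK f.crisMap (M.hdRcrisK x) :=
  f.sigmaDelta_along ((ev0 K).comp S.evσ)
    (by rw [RingHom.comp_assoc, evσ_comp_ιL, ← RingHom.comp_assoc])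
    S.evσK_comp_ι S.evσK_comp_κE x

end QuasiHom

end Comparison

section CarlitzExtension

/-! ### Free modules of rank two -/

section Pairs

variable {A B C : Type*} [CommRing A] [CommRing B] [CommRing C]

theorem mk_pair (φ : A →+* B) (p q : A) :
    BC.mk φ ((p, q) : A × A) = φ p • BC.mk φ ((1, 0) : A × A) + φ q • BC.mk φ ((0, 1) : A × A) := by
  rw [← map_smulₛₗ, ← map_smulₛₗ, ← map_add]
  simp

/-- The coordinates `A² ⊗_{A, φ} B ≅ B²`. -/
def pairCoord (φ : A →+* B) : BC φ (A × A) ≃ₗ[B] B × B :=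
  LinearEquiv.ofLinearMap
    (BC.lift (RingHom.id B) (RingHom.id_comp φ)
      { toFun := fun m => (φ m.1, φ m.2)
        map_add' := fun x y => by simp
        map_smul' := fun a x => by simp })
    (LinearMap.coprod (LinearMap.toSpanSingleton B _ (BC.mk φ ((1, 0) : A × A)))
      (LinearMap.toSpanSingleton B _ (BC.mk φ ((0, 1) : A × A))))
    (by ext <;> simp)
    (BC.ext_mk fun m => by
      obtain ⟨p, q⟩ := m
      rw [mk_pair φ p q]
      simp)

@[simp] theorem pairCoord_mk (φ : A →+* B) (m : A × A) :
    pairCoord φ (BC.mk φ m) = (φ m.1, φ m.2) := by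
  change BC.lift (RingHom.id B) (RingHom.id_comp φ) _ (BC.mk φ m) = _
  rw [BC.lift_mk]
  rfl

theorem pairCoord_symm (φ : A →+* B) (x y : B) :
    (pairCoord φ).symm (x, y) =
      x • BC.mk φ ((1, 0) : A × A) + y • BC.mk φ ((0, 1) : A × A) := rfl

/-- The automorphism `(x, y) ↦ (x + b y, c y)` of `B²`, for `b ∈ B` and a unit `c` of `B`. -/
def upperTriangular (b : B) (c : Bˣ) : (B × B) ≃ₗ[B] (B × B) where
  toFun m := (m.1 + b * m.2, c * m.2)
  invFun m := (m.1 - b * (↑c⁻¹ * m.2), ↑c⁻¹ * m.2)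
  map_add' x y := by ext <;> simp <;> ring
  map_smul' a x := by ext <;> simp <;> ring
  left_inv x := by ext <;> simp
  right_inv x := by ext <;> simp

@[simp] theorem upperTriangular_apply (b : B) (c : Bˣ) (m : B × B) :
    upperTriangular b c m = (m.1 + b * m.2, c * m.2) := rfl

end Pairs

variable {Fε : Type u} {K : Type v} [Field Fε] [Fintype Fε] [NontriviallyNormedField K]
  [IsUltrametricDist K] [Algebra Fε (ValRing K)] {S : BaseDatum Fε K}

/-! ### Extensions by a Carlitz module -/

namespace LocalShtuka

theorem tauAlong_mk_mk (M : LocalShtuka.{u, v, w} S) {m n : M.carrier}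
    (h : M.τ (BC.mk _ (BC.mk S.σP m)) = BC.mk _ n) {C : Type*} [CommRing C]
    (φ : PowerSeries (ValRing K) →+* C) (hφ : IsUnit (φ S.zz)) :
    M.tauAlong φ hφ (BC.mk φ (BC.mk S.σP m)) = BC.mk φ n := by
  simp [tauAlong, h]

theorem tauDtilde_mk_mk (M : LocalShtuka.{u, v, w} S) {m n : M.carrier}
    (h : M.τ (BC.mk _ (BC.mk S.σP m)) = BC.mk _ n) :
    M.tauDtilde (BC.mk S.σk (BC.mk S.π m)) = BC.mk S.π n := by
  rw [← M.tauAlong_mk_mk h S.π S.isUnit_π_zz]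
  exact congrArg (M.tauAlong S.π S.isUnit_π_zz) (BC.swap_mk_mk S.π_comp_σP.symm m)

variable (S) (b : PowerSeries (ValRing K))

/-- The Frobenius `(x, y) ↦ (σ̂(x) + b σ̂(y), (z - ζ) σ̂(y))` on `R⟦z⟧²`. -/
def carlitzExtτ : BC (algebraMap (PowerSeries (ValRing K)) S.Pz)
      (BC S.σP (PowerSeries (ValRing K) × PowerSeries (ValRing K))) ≃ₗ[S.Pz]
    BC (algebraMap (PowerSeries (ValRing K)) S.Pz)
      (PowerSeries (ValRing K) × PowerSeries (ValRing K)) :=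
  BC.compEquiv rfl ≪≫ₗ pairCoord _ ≪≫ₗ
    upperTriangular (algebraMap _ S.Pz b) (IsLocalization.Away.algebraMap_isUnit S.zz).unit ≪≫ₗ
    (pairCoord _).symm

theorem carlitzExtτ_mk_mk (m : PowerSeries (ValRing K) × PowerSeries (ValRing K)) :
    carlitzExtτ S b (BC.mk _ (BC.mk S.σP m)) =
      BC.mk (algebraMap _ S.Pz) (S.σP m.1 + b * S.σP m.2, S.zz * S.σP m.2) := by
  refine (pairCoord (algebraMap _ S.Pz)).injective ?_
  simp [carlitzExtτ]

/-- The local shtuka of rank two with `τ(x, y) = (σ̂(x) + b σ̂(y), (z - ζ) σ̂(y))`. It is an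
extension of `(R⟦z⟧, z - ζ)`, the local shtuka of the Carlitz module, by the unit object
`(R⟦z⟧, 1)`. -/
abbrev carlitzExt : LocalShtuka.{u, v, v} S where
  carrier := PowerSeries (ValRing K) × PowerSeries (ValRing K)
  τ := carlitzExtτ S b

end LocalShtuka

variable [CompleteSpace K]

namespace BaseDatum

variable (S)

/-- The inverse `ℓ₋⁻¹` in `R⟦z, z⁻¹}[ℓ₋⁻¹]`. -/
def ellInv : S.E := IsLocalization.Away.invSelf (Rig.ell S)

theorem ell_mul_ellInv : algebraMap (Rig S) S.E (Rig.ell S) * S.ellInv = 1 :=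
  IsLocalization.Away.mul_invSelf (Rig.ell S)

/-- `ℓ₋⁻¹` as a unit. -/
def ellInvUnit : S.Eˣ where
  val := S.ellInv
  inv := algebraMap (Rig S) S.E (Rig.ell S)
  val_inv := by rw [mul_comm, ell_mul_ellInv]
  inv_val := S.ell_mul_ellInv

theorem frob_ell_mul_σE_ellInv :
    algebraMap (Rig S) S.E (Rig.frob (Rig.ell S)) * S.σE S.ellInv = 1 := by
  have h := congrArg S.σE S.ell_mul_ellInv
  rwa [map_mul, map_one, ← RingHom.comp_apply S.σE, σE_comp_algebraMap] at h

theorem redE_ellInv : S.redE S.ellInv = 1 := by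
  have h := congrArg S.redE S.ell_mul_ellInv
  rwa [map_mul, map_one, ← RingHom.comp_apply S.redE, redE_comp_algebraMap, Rig.reduce_ell,
    one_mul] at h

theorem ι_zz : S.ι S.zz = algebraMap (Rig S) S.E (Rig.ofLaurent (Rig.zSubZeta S)) := by
  rw [← coeL_zz]; rfl

/-- `ℓ₋⁻¹` is a rigidification of the Carlitz module: `ℓ₋⁻¹ (z - ζ) = z σ̂(ℓ₋⁻¹)`. -/
theorem ellInv_mul_zz : S.ellInv * S.ι S.zz =
    algebraMap (Rig S) S.E (Rig.ofLaurent (HahnSeries.single 1 1)) * S.σE S.ellInv := by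
  have h := congrArg (algebraMap (Rig S) S.E) (Rig.z_mul_ell S)
  rw [map_mul, map_mul] at h
  have h1 := S.ell_mul_ellInv
  have h2 := S.frob_ell_mul_σE_ellInv
  rw [ι_zz]
  linear_combination (-S.ellInv * S.σE S.ellInv) * h +
    (algebraMap (Rig S) S.E (Rig.ofLaurent (HahnSeries.single 1 1)) * S.σE S.ellInv) * h1 -
    (S.ellInv * algebraMap (Rig S) S.E (Rig.ofLaurent (Rig.zSubZeta S))) * h2

theorem evσ_algebraMap (g : Rig S) :
    S.evσ (algebraMap (Rig S) S.E g) = Rig.expand (Rig.frob g) :=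
  RingHom.congr_fun S.evσ_comp_algebraMap g

theorem norm_constantCoeff_expand_le (f : Rig S) (h : ∀ n : ℕ, ‖f.coeff (-n)‖ ≤ ‖S.ζ‖ ^ n) :
    ‖PowerSeries.constantCoeff (Rig.expand f)‖ ≤ 1 := by
  have hp := S.norm_pos
  rw [← PowerSeries.coeff_zero_eq_constantCoeff_apply, Rig.coeff_expand]
  refine IsUltrametricDist.norm_tsum_le_of_forall_le_of_nonneg zero_le_one fun i => ?_
  refine (Rig.norm_term_le _ _ _).trans ?_
  rw [Nat.cast_zero, sub_zero]
  obtain ⟨n, rfl | rfl⟩ := i.eq_nat_or_neg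
  · rw [zpow_natCast]
    exact mul_le_one₀ (norm_le_one _) (by positivity) (pow_le_one₀ hp.le S.norm_lt_one.le)
  · rw [zpow_neg, zpow_natCast, ← div_eq_mul_inv]
    exact div_le_one_of_le₀ (h n) (by positivity)

theorem norm_constantCoeff_expand_frob_ell_le :
    ‖PowerSeries.constantCoeff (Rig.expand (Rig.frob (Rig.ell S)))‖ ≤ 1 := by
  refine norm_constantCoeff_expand_le S _ fun n => ?_
  rw [Rig.frob_coeff, FiniteField.frobeniusAlgHom_apply, norm_pow', Rig.ell_coeff,
    if_pos (by omega), Int.natAbs_neg, Int.natAbs_natCast]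
  refine (pow_le_of_le_one (norm_nonneg _) (norm_le_one _) Fintype.card_ne_zero).trans ?_
  refine (Rig.norm_ellCoeff_le S n).trans ?_
  exact pow_le_pow_of_le_one S.norm_pos.le S.norm_lt_one.le (Rig.le_choose n)

theorem norm_evkK_coeL_le (c : PowerSeries (ResField K)) : ‖S.evkK (coeL (ResField K) c)‖ ≤ 1 := by
  refine norm_constantCoeff_expand_le S (S.κ (coeL (ResField K) c)) fun n => ?_
  have hc : (S.κ (coeL (ResField K) c)).coeff (-n) = S.sec ((coeL (ResField K) c).coeff (-n)) := rfl
  rcases n with _ | n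
  · rw [pow_zero]
    exact norm_le_one _
  · have h0 : (coeL (ResField K) c).coeff (-((n + 1 : ℕ) : ℤ)) = 0 := by
      rw [PowerSeries.coeff_coe, if_pos (by omega)]
    rw [hc, h0, map_zero, norm_zero]
    exact pow_nonneg S.norm_pos.le _

theorem π_zz : S.π S.zz = HahnSeries.single 1 1 := by
  have h : IsLocalRing.residue (ValRing K) S.ζ = 0 :=
    (IsLocalRing.residue_eq_zero_iff _).2 S.ζ_mem
  change S.πL (coeL (ValRing K) S.zz) = _
  rw [coeL_zz]
  refine HahnSeries.ext (funext fun i => ?_)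
  rw [πL, laurentMap_coeff, Rig.zSubZeta, HahnSeries.coeff_sub, map_sub]
  simp only [HahnSeries.coeff_single]
  split_ifs <;> simp [h]

theorem κE_single_one : S.κE (HahnSeries.single 1 1) =
    algebraMap (Rig S) S.E (Rig.ofLaurent (HahnSeries.single 1 1)) := by
  have h : laurentMap S.sec (HahnSeries.single 1 1) = HahnSeries.single 1 1 := by
    refine HahnSeries.ext (funext fun i => ?_)
    rw [laurentMap_coeff]
    simp only [HahnSeries.coeff_single]
    split_ifs <;> simp
  exact congrArg (fun x => algebraMap (Rig S) S.E (Rig.ofLaurent x)) h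

theorem norm_evkK_π_le (c : PowerSeries (ValRing K)) : ‖S.evkK (S.π c)‖ ≤ 1 := by
  have h : S.π c = coeL (ResField K) (PowerSeries.map (IsLocalRing.residue (ValRing K)) c) :=
    RingHom.congr_fun (laurentMap_comp_coeL (IsLocalRing.residue (ValRing K))) c
  rw [h]
  exact S.norm_evkK_coeL_le _

end BaseDatum

namespace RigidifiedLocalShtuka

section Delta

variable (g : Rig S)

/-- The isomorphism `δ(x, y) = (x + g ℓ₋⁻¹ y, ℓ₋⁻¹ y)`. -/
def carlitzExtδ : BC S.ι (PowerSeries (ValRing K) × PowerSeries (ValRing K)) ≃ₗ[S.E]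
    BC S.κE (BC S.π (PowerSeries (ValRing K) × PowerSeries (ValRing K))) :=
  (pairCoord S.ι ≪≫ₗ upperTriangular (algebraMap (Rig S) S.E g * S.ellInv) S.ellInvUnit ≪≫ₗ
    (pairCoord (S.κE.comp S.π)).symm) ≪≫ₗ (BC.compEquiv rfl).symm

theorem carlitzExtδ_mk (m : PowerSeries (ValRing K) × PowerSeries (ValRing K)) :
    carlitzExtδ g (BC.mk S.ι m) =
      (S.ι m.1 + algebraMap (Rig S) S.E g * S.ellInv * S.ι m.2) • BC.mk S.κE (BC.mk S.π (1, 0)) +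
        (S.ellInv * S.ι m.2) • BC.mk S.κE (BC.mk S.π (0, 1)) := by
  simp [carlitzExtδ, pairCoord_symm, BaseDatum.ellInvUnit]

variable (b : PowerSeries (ValRing K))

theorem carlitzExtδ_comp_τ (hg : Rig.ofLaurent (HahnSeries.single 1 1) * g =
      Rig.frob g - Rig.ofLaurent (coeL _ b) * Rig.frob (Rig.ell S)) (hb : S.π b = 0)
    (x : BC S.ι (BC S.σP (PowerSeries (ValRing K) × PowerSeries (ValRing K)))) :
    carlitzExtδ g ((LocalShtuka.carlitzExt S b).tauAlong S.ι S.isUnit_ι_zz x) =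
      BC.map S.κE (LocalShtuka.carlitzExt S b).tauDtilde.toLinearMap
        (BC.swap S.σE_comp_κE
          (BC.map S.σE (carlitzExtδ g).toLinearMap (BC.swap S.σE_comp_ι.symm x))) := by
  -- the two entries of the matrix identity which are not immediate
  have h1 := S.ellInv_mul_zz
  have h2 : S.ι b + algebraMap (Rig S) S.E g * S.ellInv * S.ι S.zz =
      S.σE (algebraMap (Rig S) S.E g * S.ellInv) := by
    have h := congrArg (algebraMap (Rig S) S.E) hg
    rw [map_mul, map_sub, map_mul] at h
    have h3 := S.frob_ell_mul_σE_ellInv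
    have h4 : S.σE (algebraMap (Rig S) S.E g) = algebraMap (Rig S) S.E (Rig.frob g) :=
      RingHom.congr_fun S.σE_comp_algebraMap g
    have h5 : S.ι b = algebraMap (Rig S) S.E (Rig.ofLaurent (coeL _ b)) := rfl
    rw [map_mul, h4, h5]
    linear_combination (algebraMap (Rig S) S.E g) * h1 + S.σE S.ellInv * h -
      (algebraMap (Rig S) S.E (Rig.ofLaurent (coeL _ b))) * h3
  have hτ := fun m => (LocalShtuka.carlitzExt S b).tauAlong_mk_mk
    (LocalShtuka.carlitzExtτ_mk_mk S b m) S.ι S.isUnit_ι_zz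
  have hD := fun m => (LocalShtuka.carlitzExt S b).tauDtilde_mk_mk
    (LocalShtuka.carlitzExtτ_mk_mk S b m)
  have hz : S.κE (S.π S.zz) = algebraMap (Rig S) S.E (Rig.ofLaurent (HahnSeries.single 1 1)) := by
    rw [BaseDatum.π_zz, BaseDatum.κE_single_one]
  have hσ : ∀ p, S.σE (S.ι p) = S.ι (S.σP p) := RingHom.congr_fun S.σE_comp_ι
  induction x using BC.induction with
  | h0 => simp only [map_zero]
  | hmk c y =>
    induction y using BC.induction with
    | h0 => simp only [map_zero, smul_zero]
    | hmk d m =>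
      simp only [map_smulₛₗ, RingHom.id_apply, BC.swap_mk_mk, BC.map_mk, hτ]
      congr 2
      rw [carlitzExtδ_mk]
      simp only [LinearEquiv.coe_coe, carlitzExtδ_mk, map_add, map_smulₛₗ, RingHom.id_apply,
        BC.swap_mk_mk, BC.map_mk, hD, map_one, map_zero, mul_one, mul_zero, add_zero, zero_add]
      rw [mk_pair S.π b S.zz]
      simp only [hb, zero_smul, zero_add, map_smulₛₗ, smul_smul]
      rw [hz]
      refine congrArg₂ (· + ·) (congrArg (· • _) ?_) (congrArg (· • _) ?_)
      · simp only [map_mul, hσ] at h2 ⊢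
        linear_combination S.ι (S.σP m.2) * h2
      · simp only [map_mul, hσ]
        linear_combination S.ι (S.σP m.2) * h1
    | hadd x y hx hy => simp only [map_add, smul_add, hx, hy]
  | hadd x y hx hy => simp only [map_add, hx, hy]

theorem carlitzExtδ_mod (hgr : Rig.reduce g = 0)
    (x : BC S.redE (BC S.ι (PowerSeries (ValRing K) × PowerSeries (ValRing K)))) :
    BC.cancel S.redE_comp_κE (BC.map S.redE (carlitzExtδ g).toLinearMap x) =
      BC.compEquiv S.redE_comp_ι x := by
  have hg : S.redE (algebraMap (Rig S) S.E g) = 0 :=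
    (RingHom.congr_fun S.redE_comp_algebraMap g).trans hgr
  have hι : ∀ p, S.redE (S.ι p) = S.π p := RingHom.congr_fun S.redE_comp_ι
  induction x using BC.induction with
  | h0 => simp only [map_zero]
  | hmk c y =>
    induction y using BC.induction with
    | h0 => simp only [map_zero, smul_zero]
    | hmk d m =>
      obtain ⟨p, q⟩ := m
      simp only [map_smulₛₗ, RingHom.id_apply, BC.compEquiv_mk_mk, BC.map_mk, LinearEquiv.coe_coe,
        carlitzExtδ_mk, map_add, map_mul, hg, hι, S.redE_ellInv, BC.cancel_mk_mk, zero_mul,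
        add_zero, one_mul]
      rw [mk_pair S.π p q]
    | hadd x y hx hy => simp only [map_add, smul_add, hx, hy]
  | hadd x y hx hy => simp only [map_add, hx, hy]

end Delta

variable (b : PowerSeries (ValRing K)) (g : Rig S)
    (hg : Rig.ofLaurent (HahnSeries.single 1 1) * g =
      Rig.frob g - Rig.ofLaurent (coeL _ b) * Rig.frob (Rig.ell S))
    (hb : S.π b = 0) (hgr : Rig.reduce g = 0)

/-- A series `g ∈ R⟦z, z⁻¹}` with `z g = σ̂(g) - b σ̂(ℓ₋)` and `g ≡ b ≡ 0` modulo `𝔪_R` defines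
the rigidification `δ(x, y) = (x + g ℓ₋⁻¹ y, ℓ₋⁻¹ y)` of the extension
`LocalShtuka.carlitzExt S b`. -/
abbrev carlitzExt : RigidifiedLocalShtuka.{u, v, v} S where
  toLocalShtuka := LocalShtuka.carlitzExt S b
  δ := carlitzExtδ g
  δ_comp_τ := carlitzExtδ_comp_τ g b hg hb
  δ_mod := carlitzExtδ_mod g hgr

/-- The first coordinate on `D_K`, for the rigidified local shtuka `carlitzExt`. -/
def carlitzExtCoord : (carlitzExt b g hg hb hgr).HcrisK →ₗ[K] K :=
  LinearMap.fst K K K ∘ₗ (pairCoord ((S.evkK.comp S.π).comp S.σP)).toLinearMap ∘ₗ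
    (BC.compEquiv rfl).toLinearMap ∘ₗ (BC.compEquiv rfl).toLinearMap

theorem carlitzExtCoord_mk (m : (carlitzExt b g hg hb hgr).carrier) :
    carlitzExtCoord b g hg hb hgr (BC.mk S.evkK (BC.mk S.π (BC.mk S.σP m))) =
      S.evkK (S.π (S.σP m.1)) := by
  simp [carlitzExtCoord]

theorem norm_carlitzExtCoord_le {x : (carlitzExt b g hg hb hgr).HcrisK}
    (hx : x ∈ (carlitzExt b g hg hb hgr).HcrisIntK) :
    ‖carlitzExtCoord b g hg hb hgr x‖ ≤ 1 := by
  have hM : ∀ y : BC S.σP (carlitzExt b g hg hb hgr).carrier,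
      ∃ p, carlitzExtCoord b g hg hb hgr (BC.mk S.evkK (BC.mk S.π y)) = S.evkK (S.π p) := by
    intro y
    induction y using BC.induction with
    | h0 => exact ⟨0, by simp only [map_zero]⟩
    | hmk c m => exact ⟨c * S.σP m.1, by
        simp only [map_smulₛₗ, RingHom.id_apply, map_mul, smul_eq_mul]
        exact congrArg (S.evkK (S.π c) * ·) (carlitzExtCoord_mk b g hg hb hgr m)⟩
    | hadd y z hy hz =>
      obtain ⟨p, hp⟩ := hy
      obtain ⟨q, hq⟩ := hz
      exact ⟨p + q, by simp only [map_add, hp, hq]⟩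
  have hInt : ∀ y ∈ (carlitzExt b g hg hb hgr).HcrisInt,
      ‖carlitzExtCoord b g hg hb hgr (BC.mk S.evkK y)‖ ≤ 1 := by
    intro y hy
    induction hy using Submodule.span_induction with
    | mem y hy =>
      obtain ⟨y, rfl⟩ := hy
      obtain ⟨p, hp⟩ := hM y
      rw [hp]
      exact S.norm_evkK_π_le p
    | zero => simp
    | add y z _ _ hy hz =>
      rw [map_add, map_add]
      exact (IsUltrametricDist.norm_add_le_max _ _).trans (max_le hy hz)
    | smul c y _ hy =>
      rw [← algebraMap_smul (LaurentSeries (ResField K)) c y, map_smulₛₗ, map_smul, smul_eq_mul,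
        norm_mul]
      exact mul_le_one₀ (S.norm_evkK_coeL_le c) (norm_nonneg _) hy
  induction hx using Submodule.span_induction with
  | mem y hy =>
    obtain ⟨y, hy, rfl⟩ := hy
    exact hInt y hy
  | zero => simp
  | add y z _ _ hy hz =>
    rw [map_add]
    exact (IsUltrametricDist.norm_add_le_max _ _).trans (max_le hy hz)
  | smul c y _ hy =>
    rw [← algebraMap_smul K c y, map_smul, smul_eq_mul, norm_mul]
    exact mul_le_one₀ (norm_le_one c) (norm_nonneg _) hy

theorem carlitzExtCoord_hdRcrisK :
    carlitzExtCoord b g hg hb hgr ((carlitzExt b g hg hb hgr).hdRcrisK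
      (BC.mk S.evPK (BC.mk S.σP (0, 1)))) *
        PowerSeries.constantCoeff (Rig.expand (Rig.frob (Rig.ell S))) =
      PowerSeries.constantCoeff (Rig.expand (Rig.frob g)) := by
  have h := (carlitzExt b g hg hb hgr).sigmaDelta_mk_mk ((ev0 K).comp S.evσ) S.evσK_comp_ι
    S.evσK_comp_κE (0, 1)
  have hδ := carlitzExtδ_mk g (0, 1)
  rw [hδ] at h
  have h1 := congrArg (fun x => PowerSeries.constantCoeff (S.evσ x)) S.ell_mul_ellInv
  simp only [map_mul, map_one, BaseDatum.evσ_algebraMap] at h1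
  have hs : ∀ m, (carlitzExt b g hg hb hgr).sigmaDtilde (BC.mk S.σk (BC.mk S.π m)) =
    BC.mk S.π (BC.mk S.σP m) := fun m => BC.swap_mk_mk _ _
  rw [hdRcrisK, h]
  simp only [map_add, map_smulₛₗ, RingHom.id_apply, BC.swap_mk_mk, BC.map_mk, LinearEquiv.coe_coe,
    hs, map_one, map_zero, mul_one, zero_add, smul_eq_mul, map_mul, RingHom.comp_apply,
    BaseDatum.evσ_algebraMap]
  erw [carlitzExtCoord_mk b g hg hb hgr (1, 0), carlitzExtCoord_mk b g hg hb hgr (0, 1)]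
  simp only [map_one, map_zero, mul_zero, add_zero, mul_one]
  linear_combination PowerSeries.constantCoeff (Rig.expand (Rig.frob g)) * h1

end RigidifiedLocalShtuka

end CarlitzExtension

section Series

variable {Fε : Type u} {K : Type v} [Field Fε] [Fintype Fε] [NontriviallyNormedField K]
  [IsUltrametricDist K] [Algebra Fε (ValRing K)] [CompleteSpace K] {S : BaseDatum Fε K}

/-! ### A series with a large value at `z = ζ` -/

/-- The coefficients of the solution `g = ∑_{m ≥ 0} g_m z^{-m}` of `z g = σ̂(g) + t σ̂(ℓ₋)`. -/
def extCoeff (S : BaseDatum Fε K) (t : ValRing K) : ℕ → ValRing K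
  | 0 => 0
  | m + 1 => extCoeff S t m ^ Fintype.card Fε + t * Rig.ellCoeff S m ^ Fintype.card Fε

variable {t : ValRing K}

theorem norm_lt_one_of_pow_eq (ht : t ^ 4 = S.ζ) : ‖t‖ < 1 := by
  have h := S.norm_lt_one
  rw [← ht, norm_pow'] at h
  exact (pow_lt_one_iff_of_nonneg (norm_nonneg _) (by norm_num)).1 h

theorem norm_pos_of_pow_eq (ht : t ^ 4 = S.ζ) : 0 < ‖t‖ := by
  refine norm_pos_iff.2 fun h => S.ζ_ne_zero ?_
  rw [← ht, h, zero_pow (by norm_num)]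

theorem norm_extCoeff_le (hq : Fintype.card Fε = 3) (ht : t ^ 4 = S.ζ) (m : ℕ) :
    ‖extCoeff S t m‖ ≤ ‖t‖ ^ (m + 1).choose 2 := by
  have hp := norm_nonneg t
  have hl := norm_le_one t
  induction m with
  | zero => rw [extCoeff, norm_zero]; positivity
  | succ m ih =>
    have h1 := Rig.le_choose m
    have h2 : (m + 1 + 1).choose 2 = (m + 1) + (m + 1).choose 2 := by
      rw [Nat.choose_succ_succ (m + 1), Nat.choose_one_right]
    rw [extCoeff, hq]
    refine (IsUltrametricDist.norm_add_le_max _ _).trans (max_le ?_ ?_)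
    · rw [norm_pow']
      rcases m with _ | m
      · rw [extCoeff, norm_zero, zero_pow (by norm_num)]; positivity
      · refine (pow_le_pow_left₀ (norm_nonneg _) ih 3).trans ?_
        rw [← pow_mul]
        exact pow_le_pow_of_le_one hp hl (by omega)
    · rw [norm_mul', norm_pow']
      have h3 := Rig.norm_ellCoeff_le S m
      rw [← ht, norm_pow', ← pow_mul] at h3
      refine (mul_le_mul_of_nonneg_left (pow_le_pow_left₀ (norm_nonneg _) h3 3) hp).trans ?_
      rw [← pow_mul, ← pow_succ']
      exact pow_le_pow_of_le_one hp hl (by omega)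

/-- The series `g = ∑_{m ≥ 0} g_m z^{-m}`. -/
def extSeries (hq : Fintype.card Fε = 3) (ht : t ^ 4 = S.ζ) : Rig S :=
  ⟨fun i => if i ≤ 0 then extCoeff S t i.natAbs else 0, (isRig_iff S _).2 fun r hr => by
    have hp := norm_pos_of_pow_eq ht
    have hl := (norm_lt_one_of_pow_eq ht).le
    refine ⟨‖t‖ ^ (-(8 * r ^ 2)), by positivity, fun i => ?_⟩
    split_ifs with hi
    · obtain ⟨n, rfl⟩ : ∃ n : ℕ, i = -n := ⟨i.natAbs, by omega⟩
      rw [Int.natAbs_neg, Int.natAbs_natCast]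
      have h2 : (2 : ℝ) * ((n + 1).choose 2 : ℕ) = n * (n + 1) := by
        rw [Nat.cast_choose_two]; push_cast; ring
      have h4 : ‖S.ζ‖ ^ (r * ((-(n : ℤ) : ℤ) : ℝ)) = ‖t‖ ^ (4 * (r * ((-(n : ℤ) : ℤ) : ℝ))) := by
        rw [← ht, norm_pow', Real.rpow_mul hp.le]
        norm_num
      calc ‖extCoeff S t n‖ * ‖S.ζ‖ ^ (r * ((-(n : ℤ) : ℤ) : ℝ))
          ≤ ‖t‖ ^ (n + 1).choose 2 * ‖t‖ ^ (4 * (r * ((-(n : ℤ) : ℤ) : ℝ))) := by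
            rw [h4]
            exact mul_le_mul_of_nonneg_right (norm_extCoeff_le hq ht n) (by positivity)
        _ = ‖t‖ ^ ((((n + 1).choose 2 : ℕ) : ℝ) + 4 * (r * ((-(n : ℤ) : ℤ) : ℝ))) := by
            rw [Real.rpow_add hp, Real.rpow_natCast]
        _ ≤ _ := by
            refine Real.rpow_le_rpow_of_exponent_ge hp hl ?_
            push_cast
            nlinarith [sq_nonneg ((n : ℝ) - 4 * r), (Nat.cast_nonneg n : (0 : ℝ) ≤ n)]
    · rw [norm_zero, zero_mul]; positivity⟩

section

variable (hq : Fintype.card Fε = 3) (ht : t ^ 4 = S.ζ)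

theorem extSeries_coeff (i : ℤ) :
    (extSeries hq ht).coeff i = if i ≤ 0 then extCoeff S t i.natAbs else 0 := rfl

theorem z_mul_extSeries : Rig.ofLaurent (HahnSeries.single 1 1) * extSeries hq ht =
    Rig.frob (extSeries hq ht) -
      Rig.ofLaurent (coeL _ (PowerSeries.C (-t))) * Rig.frob (Rig.ell S) := by
  have hsub : ∀ f g : Rig S, (f - g).coeff = f.coeff - g.coeff := fun _ _ => rfl
  have hq0 : Fintype.card Fε ≠ 0 := Fintype.card_ne_zero
  refine Rig.ext fun n => ?_
  rw [HahnSeries.ofPowerSeries_C, hsub, Pi.sub_apply, Rig.coeff_single_mul, one_mul,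
    extSeries_coeff]
  erw [Rig.coeff_single_mul]
  rw [sub_zero, Rig.frob_coeff, Rig.frob_coeff, extSeries_coeff, Rig.ell_coeff,
    FiniteField.frobeniusAlgHom_apply, FiniteField.frobeniusAlgHom_apply]
  by_cases h1 : n - 1 ≤ 0
  · rw [if_pos h1]
    by_cases h2 : n ≤ 0
    · have : (n - 1).natAbs = n.natAbs + 1 := by omega
      rw [if_pos h2, if_pos h2, this, extCoeff]
      ring
    · have : n = 1 := by omega
      subst this
      simp [extCoeff, hq0]
  · rw [if_neg h1, if_neg (by omega), if_neg (by omega)]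
    simp [hq0]

theorem reduce_extSeries : Rig.reduce (extSeries hq ht) = 0 := by
  ext i
  rw [Rig.reduce_coeff, extSeries_coeff, HahnSeries.coeff_zero]
  split_ifs with hi
  · rw [IsLocalRing.residue_eq_zero_iff, mem_maximalIdeal_iff]
    rcases Nat.eq_zero_or_pos i.natAbs with h | h
    · rw [h, extCoeff, norm_zero]
      exact zero_lt_one
    · refine (norm_extCoeff_le hq ht _).trans_lt
        (pow_lt_one₀ (norm_nonneg _) (norm_lt_one_of_pow_eq ht) ?_)
      have := Rig.le_choose i.natAbs
      omega
  · exact map_zero _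

theorem π_C_neg (ht : t ^ 4 = S.ζ) : S.π (PowerSeries.C (-t)) = 0 := by
  have h : IsLocalRing.residue (ValRing K) (-t) = 0 := by
    rw [IsLocalRing.residue_eq_zero_iff, mem_maximalIdeal_iff, norm_neg]
    exact norm_lt_one_of_pow_eq ht
  have h2 : S.π (PowerSeries.C (-t)) = coeL (ResField K)
      (PowerSeries.map (IsLocalRing.residue (ValRing K)) (PowerSeries.C (-t))) :=
    RingHom.congr_fun (BaseDatum.laurentMap_comp_coeL (IsLocalRing.residue (ValRing K))) _
  rw [h2, PowerSeries.map_C, h, map_zero, map_zero]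

/-- The value of `σ̂(g)` at `z = ζ` is dominated by the term `g_1^3 ζ^{-1} = t^{-1}`. -/
theorem one_lt_norm_expand_frob_extSeries :
    1 < ‖PowerSeries.constantCoeff (Rig.expand (Rig.frob (extSeries hq ht)))‖ := by
  have hp := norm_pos_of_pow_eq ht
  have hl := norm_lt_one_of_pow_eq ht
  have h0 : (t : K) ≠ 0 := fun h => (norm_pos_iff.1 hp) (Subtype.ext h)
  set s : Rig S := Rig.ofLaurent (HahnSeries.single (-1) (t ^ 3)) with hs
  have hsub : ∀ f g : Rig S, (f - g).coeff = f.coeff - g.coeff := fun _ _ => rfl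
  -- the other terms are integral
  have h1 : ‖PowerSeries.constantCoeff (Rig.expand (Rig.frob (extSeries hq ht) - s))‖ ≤ 1 := by
    refine S.norm_constantCoeff_expand_le _ fun n => ?_
    rw [hsub, Pi.sub_apply, Rig.frob_coeff, FiniteField.frobeniusAlgHom_apply, extSeries_coeff,
      if_pos (by omega), Int.natAbs_neg, Int.natAbs_natCast, hs, Rig.ofLaurent_coeff, hq, ← ht,
      norm_pow', ← pow_mul]
    rcases n with _ | _ | n
    · rw [HahnSeries.coeff_single_of_ne (by simp)]
      simp [extCoeff]
    · simp [extCoeff, Rig.ellCoeff_zero, hq]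
    · rw [HahnSeries.coeff_single_of_ne (by omega), sub_zero, norm_pow']
      refine (pow_le_pow_left₀ (norm_nonneg _) (norm_extCoeff_le hq ht _) 3).trans ?_
      rw [← pow_mul]
      refine pow_le_pow_of_le_one hp.le hl.le ?_
      have h2 : ∀ m : ℕ, (m + 1 + 1).choose 2 = (m + 1) + (m + 1).choose 2 := fun m => by
        rw [Nat.choose_succ_succ (m + 1), Nat.choose_one_right]
      have h3 := Rig.le_choose n
      have h4 := h2 n
      have h5 := h2 (n + 1)
      omega
  have h2 : PowerSeries.constantCoeff (Rig.expand s) = (t : K)⁻¹ := by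
    rw [← PowerSeries.coeff_zero_eq_constantCoeff_apply, hs, Rig.expand_single, ← ht]
    simp
    field_simp
  have h3 : 1 < ‖(t : K)⁻¹‖ := by
    rw [norm_inv]
    exact (one_lt_inv₀ hp).2 hl
  by_contra hc
  rw [not_lt] at hc
  rw [map_sub, map_sub, h2] at h1
  refine absurd h3 (not_lt.2 ?_)
  rw [← norm_neg, ← sub_add_cancel (-(t : K)⁻¹)
    (-PowerSeries.constantCoeff (Rig.expand (Rig.frob (extSeries hq ht))))]
  refine (IsUltrametricDist.norm_add_le_max _ _).trans (max_le ?_ ?_)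
  · rwa [sub_neg_eq_add, neg_add_eq_sub]
  · rwa [norm_neg]

/-- For the extension defined by `b = -t`, the first coordinate of the image of the basis vector
`(0, 1)` of `H¹_dR(M, R)` is not integral. -/
theorem exists_map_HdRInt_ne (S : BaseDatum Fε K) (hq : Fintype.card Fε = 3) (ht : t ^ 4 = S.ζ) :
    ∃ M : RigidifiedLocalShtuka.{u, v, v} S,
      M.HdRInt.map (M.hdRcrisK.restrictScalars (ValRing K)) ≠ M.HcrisIntK := by
  refine ⟨RigidifiedLocalShtuka.carlitzExt _ _ (z_mul_extSeries hq ht) (π_C_neg ht)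
    (reduce_extSeries hq ht), fun h => ?_⟩
  have hmem := RigidifiedLocalShtuka.norm_carlitzExtCoord_le _ _ (z_mul_extSeries hq ht)
    (π_C_neg ht) (reduce_extSeries hq ht)
    (h.le ⟨_, Submodule.subset_span ⟨BC.mk S.σP (0, 1), rfl⟩, rfl⟩)
  have h1 := RigidifiedLocalShtuka.carlitzExtCoord_hdRcrisK _ _ (z_mul_extSeries hq ht)
    (π_C_neg ht) (reduce_extSeries hq ht)
  have h2 := one_lt_norm_expand_frob_extSeries hq ht
  rw [← h1, norm_mul] at h2
  exact absurd h2 (not_lt.2 (mul_le_one₀ hmem (norm_nonneg _)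
    S.norm_constantCoeff_expand_frob_ell_le))

end

end Series

/-! ### The field of Laurent series -/

namespace LaurentField

variable (F : Type v) [Field F]

instance : (Valued.v :
    Valuation (LaurentSeries F) (WithZero (Multiplicative ℤ))).IsRankOneDiscrete := by
  rw [LaurentSeries.valuation_def]
  infer_instance

/-- The order valuation of `F((t))` has rank one. The choice of the base `2` means that
`|t| = 1/2`. -/
instance : (Valued.v : Valuation (LaurentSeries F) (WithZero (Multiplicative ℤ))).RankOne :=
  Valuation.IsRankOneDiscrete.rankOne _ one_lt_two

/-- The `t`-adic absolute value on `F((t))`. -/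
instance : NontriviallyNormedField (LaurentSeries F) :=
  Valued.toNontriviallyNormedField (LaurentSeries F) (WithZero (Multiplicative ℤ))

instance : IsUltrametricDist (LaurentSeries F) :=
  inferInstanceAs (@IsUltrametricDist (LaurentSeries F)
    (Valued.toNormedField (LaurentSeries F) (WithZero (Multiplicative ℤ))).toDist)

instance : CompleteSpace (LaurentSeries F) := LaurentSeries.instLaurentSeriesComplete

variable {F}

theorem norm_le_one_iff (x : LaurentSeries F) : ‖x‖ ≤ 1 ↔ ∃ p, coeL F p = x :=
  Valued.toNormedField.norm_le_one_iff.trans (LaurentSeries.val_le_one_iff_eq_coe F x)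

/-- The inclusion of `F⟦t⟧` into the valuation ring of `F((t))`. -/
def ofPowerSeries : PowerSeries F →+* ValRing (LaurentSeries F) :=
  (coeL F).codRestrict _ fun p => (mem_valRing _).2 ((norm_le_one_iff _).2 ⟨p, rfl⟩)

theorem exists_ofPowerSeries_eq (x : ValRing (LaurentSeries F)) : ∃ p, ofPowerSeries p = x := by
  obtain ⟨p, hp⟩ := (norm_le_one_iff _).1 ((mem_valRing _).1 x.2)
  exact ⟨p, Subtype.ext hp⟩

theorem ofPowerSeries_injective : Function.Injective (ofPowerSeries (F := F)) := fun _ _ h =>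
  HahnSeries.ofPowerSeries_injective (congrArg Subtype.val h)

/-- The valuation ring of `F((t))` is `F⟦t⟧`. -/
def powerSeriesEquiv : PowerSeries F ≃+* ValRing (LaurentSeries F) :=
  RingEquiv.ofBijective ofPowerSeries ⟨ofPowerSeries_injective, exists_ofPowerSeries_eq⟩

instance : Algebra F (ValRing (LaurentSeries F)) :=
  ((powerSeriesEquiv (F := F)).toRingHom.comp PowerSeries.C).toAlgebra

/-- The constant coefficient, on the valuation ring of `F((t))`. -/
def constCoeff : ValRing (LaurentSeries F) →+* F :=
  PowerSeries.constantCoeff.comp (powerSeriesEquiv (F := F)).symm.toRingHom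

theorem mem_maximalIdeal_iff_constCoeff (x : ValRing (LaurentSeries F)) :
    x ∈ IsLocalRing.maximalIdeal (ValRing (LaurentSeries F)) ↔ constCoeff x = 0 := by
  rw [IsLocalRing.mem_maximalIdeal, mem_nonunits_iff, not_iff_comm, constCoeff, RingHom.comp_apply,
    ← ne_eq, ← isUnit_iff_ne_zero, ← PowerSeries.isUnit_iff_constantCoeff]
  exact MulEquiv.isUnit_map (powerSeriesEquiv (F := F)).symm

/-- The base datum with `ζ = t^4` for the residue field `F` of `F((t))`, with the section given by
the constant power series. -/
def baseDatum (F : Type v) [Field F] [Fintype F] : BaseDatum F (LaurentSeries F) where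
  ζ := powerSeriesEquiv PowerSeries.X ^ 4
  ζ_ne_zero := by
    rw [← map_pow, ne_eq, map_eq_zero_iff _ powerSeriesEquiv.injective]
    exact pow_ne_zero 4 PowerSeries.X_ne_zero
  ζ_mem := by
    rw [mem_maximalIdeal_iff_constCoeff, map_pow]
    simp [constCoeff]
  sec := (algebraMap F (ValRing (LaurentSeries F))).comp
    (Ideal.Quotient.lift _ constCoeff fun x hx => (mem_maximalIdeal_iff_constCoeff x).1 hx)
  residue_comp_sec := by
    refine Ideal.Quotient.ringHom_ext (RingHom.ext fun x => ?_)
    change IsLocalRing.residue _ (algebraMap F (ValRing (LaurentSeries F)) (constCoeff x)) =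
      IsLocalRing.residue _ x
    rw [← sub_eq_zero, ← map_sub, IsLocalRing.residue_eq_zero_iff, mem_maximalIdeal_iff_constCoeff,
      map_sub, sub_eq_zero]
    change PowerSeries.constantCoeff (powerSeriesEquiv.symm (powerSeriesEquiv
      (PowerSeries.C (constCoeff x)))) = _
    simp

end LaurentField

end LocSht

end

theorem mainTheorem4 :
    -- the comparison isomorphisms, for every base and every rigidified local shtuka
    (∀ (Fε : Type u) (K : Type v) [Field Fε] [Fintype Fε] [NontriviallyNormedField K]
        [IsUltrametricDist K] [CompleteSpace K] [Algebra Fε (LocSht.ValRing K)]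
        (S : LocSht.BaseDatum Fε K),
      (∀ M : LocSht.RigidifiedLocalShtuka.{u, v, w} S,
        -- both comparison maps are isomorphisms, and they agree modulo `z - ζ`
        Function.Bijective M.hdRcris ∧ Function.Bijective M.hdRcrisK ∧
        (∀ x : M.HdR, M.hdRcrisK (M.redHdR x) = M.redHcris (M.hdRcris x)) ∧
        -- compatibility with the Hodge–Pink lattices and with the Hodge–Pink filtrations
        M.qdR.map (M.hdRcrisX.restrictScalars (PowerSeries K)) = M.qD ∧
        ∀ i : ℤ, (M.filHdR i).map M.hdRcrisK = M.filDK i) ∧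
      -- functoriality
      (∀ (M N : LocSht.RigidifiedLocalShtuka.{u, v, w} S) (f : LocSht.QuasiHom M N),
        (∀ x : M.HdR,
          N.hdRcris (f.dRMap x) = BC.map S.evk f.crisMap (M.hdRcris x)) ∧
        ∀ x : M.HdRK,
          N.hdRcrisK (f.dRMapK x) = BC.map S.evkK f.crisMap (M.hdRcrisK x))) ∧
    -- the integral structures are not preserved in general
    ∃ (Fε K : Type) (_ : Field Fε) (_ : Fintype Fε) (_ : NontriviallyNormedField K)
      (_ : IsUltrametricDist K) (_ : CompleteSpace K) (_ : Algebra Fε (LocSht.ValRing K))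
      (S : LocSht.BaseDatum Fε K) (M : LocSht.RigidifiedLocalShtuka.{0, 0, 0} S),
      M.HdRInt.map (M.hdRcrisK.restrictScalars (LocSht.ValRing K)) ≠ M.HcrisIntK := by
  refine ⟨fun Fε K _ _ _ _ _ _ S => ⟨fun M => ⟨M.sigmaDelta_bijective _ _ _,
    M.sigmaDelta_bijective _ _ _, M.hdRcrisK_redHdR, M.map_hdRcrisX_qdR, M.map_hdRcrisK_filHdR⟩,
    fun M N f => ⟨f.hdRcris_dRMap, f.hdRcrisK_dRMapK⟩⟩, ?_⟩
  have : Fact (Nat.Prime 3) := ⟨Nat.prime_three⟩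
  obtain ⟨M, hM⟩ := LocSht.exists_map_HdRInt_ne (LocSht.LaurentField.baseDatum (ZMod 3))
    (ZMod.card 3) (t := LocSht.LaurentField.powerSeriesEquiv PowerSeries.X) rfl
  exact ⟨ZMod 3, LaurentSeries (ZMod 3), inferInstance, inferInstance, inferInstance,
    inferInstance, inferInstance, inferInstance, LocSht.LaurentField.baseDatum (ZMod 3), M, hM⟩
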